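/- **Setting.** Let $m\ge 2$, $n\ge 2$, let $C\in\mathbb R_+^{n\times\cdots\times n}$ be a nonnegative cost tensor of order $m$, and let $r_1,\dots,r_m\in\Delta^n=\{u\in\mathbb R^n_+:\sum_j u_j=1\}$. For a tensor $A$ of the same shape put $[r_k(A)]_j=\sum_{i:\,i_k=j}A_{i_1\ldots i_m}$, $\|A\|_1=\sum_i|A_i|$, $\|A\|_\infty=\max_i|A_i|$ and $\langle C,A\rangle=\sum_i C_iA_i$. A *multimarginal transportation plan* is a tensor $X\ge 0$ with $r_k(X)=r_k$ for all $k\in[m]$; a plan $\widehat X$ is an *$\varepsilon$-approximate plan* if $\langle C,\widehat X\rangle\le\langle C,X^\star\rangle+\varepsilon$, where $X^\star$ is a plan of least cost $\langle C,X^\star\rangle$. **Algorithm** (input $C,(r_k),\varepsilon$). Put $\eta=\frac{\varepsilon}{2m\log n}$, $\varepsilon'=\frac{\varepsilon}{8\|C\|_\infty}$, $\tilde r_k=\left(1-\frac{\varepsilon'}{4m}\right)r_k+\frac{\varepsilon'}{4mn}\mathbf 1_n$, and for $\beta\in(\mathbb R^n)^m$ $$B(\beta)_{i_1\ldots i_m}=\exp\Big(\sum_{k}\beta_{k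 i_k}-\tfrac{C_{i_1\ldots i_m}}{\eta}\Big),\quad \varphi(\beta)=\log\|B(\beta)\|_1-\sum_k\beta_k^\top\tilde r_k,\quad \rho(a,b)=\sum_j(b_j-a_j)+\sum_j a_j\log\frac{a_j}{b_j}.$$ The *block update* of $\beta$ at $K$ replaces $\beta_K$ by $\beta_K+\log\tilde r_K-\log r_K(B(\beta))$ and leaves the other blocks unchanged. (i) *Accelerated multimarginal Sinkhorn.* Start with $\theta_0=1$, $K=1$, $\check\beta^0=\tilde\beta^0=0$. For $t=0,1,2,\dots$: 1. $\bar\beta^t=(1-\theta_t)\check\beta^t+\theta_t\tilde\beta^t$; 2. $\tilde\beta_k^{t+1}=\tilde\beta_k^t-\frac1{m\theta_t}\Big(\frac{r_k(B(\bar\beta^t))}{\|B(\bar\beta^t)\|_1}-\tilde r_k\Big)$ for all $k$; 3. $\grave\beta^t=\bar\beta^t+\theta_t(\tilde\beta^{t+1}-\tilde\beta^t)$; 4. $\widehat\beta^t$ is the block update of $\grave\beta^t$ at $K$; 5. $\beta^t\in\operatorname{argmin}\{\varphi(\beta):\beta\in\{\check\beta^t,\widehat\beta^t\}\}$; if $E_t:=\sum_k\|r_k(B(\beta^t))-\tilde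 r_k\|_1\le\varepsilon'/2$, stop with $\widetilde X=B(\beta^t)$; 6. choose a new $K\in\operatorname{argmax}_k\rho(\tilde r_k,r_k(B(\beta^t)))$; 7. $\check\beta^{t+1}$ is the block update of $\beta^t$ at $K$; 8. $\theta_{t+1}=\theta_t\big(\sqrt{\theta_t^2+4}-\theta_t\big)/2$. (ii) *Rounding.* Put $X^{(0)}=\widetilde X$. For $k=1,\dots,m$ put $z_k=\min\{\mathbf 1_n,\,r_k/r_k(X^{(k-1)})\}$ and $X^{(k)}_{i_1\ldots i_m}=z_{k i_k}X^{(k-1)}_{i_1\ldots i_m}$. With $\mathrm{err}_k=r_k-r_k(X^{(m)})$, output $\widehat X_{i_1\ldots i_m}=X^{(m)}_{i_1\ldots i_m}+\|\mathrm{err}_1\|_1^{-(m-1)}\prod_{k}\mathrm{err}_{k i_k}$ (nothing is added if $\mathrm{err}_1=0$). **Theorem.** There is an absolute constant $c>0$ such that, for all $m,n\ge 2$, all nonnegative $C$, all $r_1,\dots,r_m\in\Delta^n$, all $\varepsilon$ with $0<\varepsilon\le 32\,m\,\|C\|_\infty$ (that is, $\varepsilon'\le 4m$, so that the $\tilde r_k$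 are convex combinations of $r_k$ and the uniform vector), and however ties in steps 5 and 6 are broken, the algorithm terminates and returns an $\varepsilon$-approximate multimarginal transportation plan $\widehat X$ within at most $$c\cdot\frac{m^3\,n^{m+1/3}\,\|C\|_\infty^{4/3}\,(\log n)^{2/3}}{\varepsilon^{4/3}}$$ arithmetic operations. Each exact real operation $+,-,\times,/,\min,\max,|\cdot|,\sqrt{\cdot},\exp,\log$, each comparison, and each loading of an integer constant counts as one operation. -/

import Mathlib

namespace MOT

/-! ### Arithmetic programs and their operation counts

A program computes with numbers of an abstract type `V`. The only way in which a program that is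
polymorphic in `V` can produce a number is one of the elementary instructions below, and the only
way in which it can branch on numbers is a comparison. Every executed instruction costs one. -/

/-- Binary arithmetic instructions. -/
inductive BinOp where
  | add | sub | mul | div | min | max

/-- Unary arithmetic instructions. -/
inductive UnOp where
  | abs | sqrt | exp | log

/-- Programs over numbers of type `V` that return an object of type `α`. -/
inductive Prog (V : Type) (α : Type) : Type where
  /-- stop and return -/
  | ret (a : α) : Prog V α
  /-- load a natural number as a constant -/
  | lit (c : ℕ) (next : V → Prog V α) : Prog V α
  /-- one unary arithmetic operation -/
  | un (o : UnOp) (x : V) (next : V → Prog V α) : Prog V α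
  /-- one binary arithmetic operation -/
  | bin (o : BinOp) (x y : V) (next : V → Prog V α) : Prog V α
  /-- one (three-way) comparison -/
  | cmp (x y : V) (next : Ordering → Prog V α) : Prog V α

namespace Prog

/-- Sequential composition. -/
def bind {V α β : Type} : Prog V α → (α → Prog V β) → Prog V β
  | ret a, f => f a
  | lit c k, f => lit c fun v => bind (k v) f
  | un o x k, f => un o x fun v => bind (k v) f
  | bin o x y k, f => bin o x y fun v => bind (k v) f
  | cmp x y k, f => cmp x y fun b => bind (k b) f

instance {V : Type} : Monad (Prog V) where
  pure := ret
  bind := bind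

end Prog

noncomputable section

/-- Exact real semantics of the binary instructions. -/
def BinOp.eval : BinOp → ℝ → ℝ → ℝ
  | .add, x, y => x + y
  | .sub, x, y => x - y
  | .mul, x, y => x * y
  | .div, x, y => x / y
  | .min, x, y => Min.min x y
  | .max, x, y => Max.max x y

/-- Exact real semantics of the unary instructions. -/
def UnOp.eval : UnOp → ℝ → ℝ
  | .abs, x => |x|
  | .sqrt, x => Real.sqrt x
  | .exp, x => Real.exp x
  | .log, x => Real.log x

/-- Execution in exact real arithmetic: the returned object and the number of executed
instructions. -/
def Prog.run {α : Type} : Prog ℝ α → α × ℕ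
  | .ret a => (a, 0)
  | .lit c k => ((k (c : ℝ)).run.1, (k (c : ℝ)).run.2 + 1)
  | .un o x k => ((k (o.eval x)).run.1, (k (o.eval x)).run.2 + 1)
  | .bin o x y k => ((k (o.eval x y)).run.1, (k (o.eval x y)).run.2 + 1)
  | .cmp x y k =>
      ((k (if x < y then .lt else if x = y then .eq else .gt)).run.1,
        (k (if x < y then .lt else if x = y then .eq else .gt)).run.2 + 1)

section Instructions

variable {V : Type}

def lit (c : ℕ) : Prog V V := .lit c .ret
def add (x y : V) : Prog V V := .bin .add x y .ret
def sub (x y : V) : Prog V V := .bin .sub x y .ret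
def mul (x y : V) : Prog V V := .bin .mul x y .ret
def div (x y : V) : Prog V V := .bin .div x y .ret
def minimum (x y : V) : Prog V V := .bin .min x y .ret
def maximum (x y : V) : Prog V V := .bin .max x y .ret
def abs (x : V) : Prog V V := .un .abs x .ret
def sqrt (x : V) : Prog V V := .un .sqrt x .ret
def exp (x : V) : Prog V V := .un .exp x .ret
def log (x : V) : Prog V V := .un .log x .ret
def compare (x y : V) : Prog V Ordering := .cmp x y .ret

end Instructions

/-! ### Arrays, sums, products -/

section Arrays

variable {V : Type}

/-- Compute the entries `f 0, f 1, …` one after the other and store them. -/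
def tabulateFin {α : Type} : (N : ℕ) → (Fin N → Prog V α) → Prog V (Fin N → α)
  | 0, _ => pure Fin.elim0
  | N + 1, f => do
      let a ← f 0
      let rest ← tabulateFin N fun i => f i.succ
      pure (Fin.cons a rest)

/-- Compute and store an array indexed by any finite type. -/
def tabulate {ι α : Type} [Fintype ι] (f : ι → Prog V α) : Prog V (ι → α) := do
  let a ← tabulateFin (Fintype.card ι) fun i => f ((Fintype.equivFin ι).symm i)
  pure fun i => a (Fintype.equivFin ι i)

def sumList : List V → Prog V V
  | [] => lit 0
  | x :: l => do
      let s ← sumList l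
      add x s

def prodList : List V → Prog V V
  | [] => lit 1
  | x :: l => do
      let s ← prodList l
      mul x s

def maxList : List V → Prog V V
  | [] => lit 0
  | x :: l => do
      let s ← maxList l
      maximum x s

/-- `∑ i, x i` -/
def sum {ι : Type} [Fintype ι] (x : ι → V) : Prog V V :=
  sumList (Finset.univ.toList.map x)

/-- `‖x‖₁ = ∑ i, |x i|` -/
def norm1 {ι : Type} [Fintype ι] (x : ι → V) : Prog V V := do
  let y ← tabulate fun i => abs (x i)
  sum y

/-- `‖x‖_∞ = max_i |x i|` -/
def normInf {ι : Type} [Fintype ι] (x : ι → V) : Prog V V := do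
  let y ← tabulate fun i => abs (x i)
  maxList (Finset.univ.toList.map y)

end Arrays

/-! ### Tensors -/

/-- Tensors of order `m` with all sides equal to `n`. -/
abbrev Tensor (m n : ℕ) (V : Type) : Type := (Fin m → Fin n) → V

/-- Families of `m` vectors of length `n`. -/
abbrev Vecs (m n : ℕ) (V : Type) : Type := Fin m → Fin n → V

section Algorithms

variable {V : Type} {m n : ℕ}

/-- The `k`-th marginal `r_k(A)`. -/
def marginal (A : Tensor m n V) (k : Fin m) : Prog V (Fin n → V) :=
  tabulate fun j : Fin n =>
    sumList ((Finset.univ.filter fun i : Fin m → Fin n => i k = j).toList.map A)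

/-- All marginals. -/
def marginals (A : Tensor m n V) : Prog V (Vecs m n V) :=
  tabulate fun k => marginal A k

/-- The tensor `B(β)` with entries `exp (∑ k, β_{k, i_k} - C_i / η)`. -/
def gibbs (C : Tensor m n V) (η : V) (β : Vecs m n V) : Prog V (Tensor m n V) :=
  tabulate fun i => do
    let s ← sum fun k => β k (i k)
    let q ← div (C i) η
    let e ← sub s q
    exp e

/-- The dual objective `φ(β) = log ‖B(β)‖₁ - ∑ k, ⟨β_k, r_k⟩`. -/
def dualObj (C : Tensor m n V) (η : V) (r : Vecs m n V) (β : Vecs m n V) : Prog V V := do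
  let B ← gibbs C η β
  let M ← norm1 B
  let l ← log M
  let p ← tabulate fun k => do
    let q ← tabulate fun j => mul (β k j) (r k j)
    sum q
  let s ← sum p
  sub l s

/-- `ρ(a, b) = ∑ i, (b_i - a_i) + ∑ i, a_i log (a_i / b_i)`. -/
def rho (a b : Fin n → V) : Prog V V := do
  let d ← tabulate fun i => sub (b i) (a i)
  let s ← sum d
  let e ← tabulate fun i => do
    let q ← div (a i) (b i)
    let l ← log q
    mul (a i) l
  let u ← sum e
  add s u

/-- An index of a largest entry of `v`, found by a scan that starts at `k₀`. When the entry at `k`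
equals the largest one found so far, `tie k` decides whether to move on to `k`. -/
def argmax (tie : Fin m → Bool) (k₀ : Fin m) (v : Fin m → V) : Prog V (Fin m) :=
  (List.finRange m).foldlM
    (fun best k => do
      match ← compare (v best) (v k) with
      | .lt => pure k
      | .eq => pure (if tie k then k else best)
      | .gt => pure best) k₀

/-- The block update `β_K ← β_K + log r_K - log r_K(B(β))`, other blocks unchanged. -/
def blockUpdate (C : Tensor m n V) (η : V) (r : Vecs m n V) (K : Fin m) (β : Vecs m n V) :
    Prog V (Vecs m n V) := do
  let B ← gibbs C η β
  let q ← marginal B K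
  let new ← tabulate fun j => do
    let a ← log (r K j)
    let b ← log (q j)
    let c ← add (β K j) a
    sub c b
  pure (Function.update β K new)

/-- How the two `arg max` / `arg min` choices of the accelerated algorithm are resolved when there
is more than one solution: `coord t` for the greedy coordinate and `keep t` for the monotone search
step of iteration `t`. -/
structure TieRule (m : ℕ) where
  coord : ℕ → Fin m → Bool
  keep : ℕ → Bool

/-- What is carried from one iteration of the accelerated algorithm to the next:
`θ = θ_t`, the current coordinate `K`, `check = β̌^t` and `tilde = β̃^t`. -/
structure AccState (m n : ℕ) (V : Type) where
  θ : V
  K : Fin m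
  check : Vecs m n V
  tilde : Vecs m n V

/-- Steps 1 to 5 of iteration `t`: returns `(β̃^{t+1}, β^t)`. -/
def accFirstHalf (tie : TieRule m) (C : Tensor m n V) (η : V) (r : Vecs m n V) (t : ℕ)
    (s : AccState m n V) : Prog V (Vecs m n V × Vecs m n V) := do
  -- Step 1: `β̄ = (1 - θ) β̌ + θ β̃`
  let one ← lit 1
  let oneSub ← sub one s.θ
  let bar ← tabulate fun k => tabulate fun j => do
    let a ← mul oneSub (s.check k j)
    let b ← mul s.θ (s.tilde k j)
    add a b
  -- Step 2: `β̃'_k = β̃_k - (1 / (m θ)) (r_k(B(β̄)) / ‖B(β̄)‖₁ - r_k)`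
  let B ← gibbs C η bar
  let M ← norm1 B
  let q ← marginals B
  let mV ← lit m
  let mθ ← mul mV s.θ
  let step ← div one mθ
  let tilde' ← tabulate fun k => tabulate fun j => do
    let a ← div (q k j) M
    let g ← sub a (r k j)
    let d ← mul step g
    sub (s.tilde k j) d
  -- Step 3: `β̀ = β̄ + θ (β̃' - β̃)`
  let grave ← tabulate fun k => tabulate fun j => do
    let d ← sub (tilde' k j) (s.tilde k j)
    let e ← mul s.θ d
    add (bar k j) e
  -- Step 4: `β̂` = block update of `β̀` at `K`
  let hat ← blockUpdate C η r s.K grave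
  -- Step 5: the better of `β̌` and `β̂`
  let fCheck ← dualObj C η r s.check
  let fHat ← dualObj C η r hat
  let β ← (do
    match ← compare fCheck fHat with
    | .lt => pure s.check
    | .eq => pure (if tie.keep t then s.check else hat)
    | .gt => pure hat)
  pure (tilde', β)

/-- The residue `E = ∑ k, ‖r_k(B) - r_k‖₁`. -/
def residue (r : Vecs m n V) (B : Tensor m n V) : Prog V V := do
  let q ← marginals B
  let e ← tabulate fun k => do
    let d ← tabulate fun j => sub (q k j) (r k j)
    norm1 d
  sum e

/-- Steps 6 to 8 of iteration `t`, given `β̃^{t+1}`, `β^t` and `B(β^t)`. -/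
def accSecondHalf (tie : TieRule m) (C : Tensor m n V) (η : V) (r : Vecs m n V) (k₀ : Fin m)
    (t : ℕ) (s : AccState m n V) (tilde' β : Vecs m n V) (B : Tensor m n V) :
    Prog V (AccState m n V) := do
  -- Step 6: greedy coordinate
  let q ← marginals B
  let v ← tabulate fun k => rho (r k) (q k)
  let K ← argmax (tie.coord t) k₀ v
  -- Step 7: `β̌'` = block update of `β` at `K`
  let check' ← blockUpdate C η r K β
  -- Step 8: `θ' = θ (√(θ² + 4) - θ) / 2`
  let two ← lit 2
  let four ← lit 4
  let a ← mul s.θ s.θ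
  let b ← add a four
  let c ← sqrt b
  let d ← sub c s.θ
  let e ← mul s.θ d
  let θ' ← div e two
  pure { θ := θ', K := K, check := check', tilde := tilde' }

/-- The loop of the accelerated multimarginal Sinkhorn algorithm, entered at iteration `t`. The loop
stops and returns `B(β^t)` as soon as `E_t ≤ ε'`. The bound `fuel` on the number of tests of the
stopping criterion only serves to make this a terminating definition: if it is exhausted the result
is `none`; otherwise it has no influence on the result or on the operation count. -/
def accLoop (tie : TieRule m) (C : Tensor m n V) (η : V) (r : Vecs m n V) (ε' : V) (k₀ : Fin m) :
    (fuel : ℕ) → (t : ℕ) → AccState m n V → Prog V (Option (Tensor m n V))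
  | 0, _, _ => pure none
  | fuel + 1, t, s => do
      let (tilde', β) ← accFirstHalf tie C η r t s
      let B ← gibbs C η β
      let E ← residue r B
      match ← compare E ε' with
      | .gt =>
          let s' ← accSecondHalf tie C η r k₀ t s tilde' β B
          accLoop tie C η r ε' k₀ fuel (t + 1) s'
      | _ => pure (some B)

/-- Accelerated multimarginal Sinkhorn, started at `β̌^0 = β̃^0 = 0`, `θ_0 = 1`, `K = k₀`. -/
def accSinkhorn (tie : TieRule m) (C : Tensor m n V) (η : V) (r : Vecs m n V) (ε' : V)
    (k₀ : Fin m) (fuel : ℕ) : Prog V (Option (Tensor m n V)) := do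
  let one ← lit 1
  let zero ← lit 0
  accLoop tie C η r ε' k₀ fuel 0
    { θ := one, K := k₀, check := fun _ _ => zero, tilde := fun _ _ => zero }

/-- The rounding scheme: scale the tensor along `k = 1, …, m` by
`z_k = min {1, r_k / r_k(X)}`, then add the rank-one tensor `⨂ err_k / ‖err_1‖₁^(m-1)`, where
`err_k = r_k - r_k(X)`. If the denominator is zero then `err = 0`, and nothing is added
(by the convention `0 / 0 = 0`). -/
def round (X : Tensor m n V) (r : Vecs m n V) (k₀ : Fin m) : Prog V (Tensor m n V) := do
  let one ← lit 1
  let X' ← (List.finRange m).foldlM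
    (fun (X : Tensor m n V) (k : Fin m) => do
      let q ← marginal X k
      let z ← tabulate fun j => do
        let a ← div (r k j) (q j)
        minimum one a
      tabulate fun i => mul (z (i k)) (X i)) X
  let q ← marginals X'
  let err ← tabulate fun k => tabulate fun j => sub (r k j) (q k j)
  let M ← norm1 (err k₀)
  let den ← prodList (List.replicate (m - 1) M)
  tabulate fun i => do
    let p ← prodList ((List.finRange m).map fun k => err k (i k))
    let u ← div p den
    add (X' i) u

/-- Approximating the multimarginal optimal transport problem with cost `C` and marginals `r` up to
accuracy `ε`: perturb the marginals, run accelerated multimarginal Sinkhorn, round. -/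
def approxMOT (tie : TieRule m) (C : Tensor m n V) (r : Vecs m n V) (ε : V) (k₀ : Fin m)
    (fuel : ℕ) : Prog V (Option (Tensor m n V)) := do
  let one ← lit 1
  let two ← lit 2
  let four ← lit 4
  let eight ← lit 8
  let mV ← lit m
  let nV ← lit n
  -- `η = ε / (2 m log n)`
  let ln ← log nV
  let tm ← mul two mV
  let d ← mul tm ln
  let η ← div ε d
  -- `ε' = ε / (8 ‖C‖_∞)`
  let c ← normInf C
  let ec ← mul eight c
  let ε' ← div ε ec
  -- Step 1: `r̃_k = (1 - ε' / (4 m)) r_k + ε' / (4 m n) 1_n`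
  let fm ← mul four mV
  let a ← div ε' fm
  let b ← sub one a
  let fmn ← mul fm nV
  let u ← div ε' fmn
  let r' ← tabulate fun k => tabulate fun j => do
    let x ← mul b (r k j)
    add x u
  -- Step 2, with tolerance `ε' / 2`
  let tol ← div ε' two
  match ← accSinkhorn tie C η r' tol k₀ fuel with
  | none => pure none
  -- Step 3: round to the prescribed marginals
  | some X => do
      let Y ← round X r k₀
      pure (some Y)

end Algorithms

/-- The algorithm `p` (with its artificial bound on loop iterations as argument) terminates,
returns `a`, and executes exactly `N` instructions. -/
def Returns {α : Type} (p : ℕ → Prog ℝ (Option α)) (a : α) (N : ℕ) : Prop :=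
  ∃ fuel, (p fuel).run = (some a, N)

/-! ### The multimarginal optimal transport problem -/

/-- `⟨C, X⟩ = ∑ i, C_i X_i`. -/
def cost {m n : ℕ} (C X : Tensor m n ℝ) : ℝ := ∑ i, C i * X i

/-- Multimarginal transportation plans: nonnegative tensors with `k`-th marginal `r_k`. -/
def IsPlan {m n : ℕ} (r : Vecs m n ℝ) (X : Tensor m n ℝ) : Prop :=
  (∀ i, 0 ≤ X i) ∧
    ∀ k j, ∑ i ∈ Finset.univ.filter (fun i : Fin m → Fin n => i k = j), X i = r k j

/-- Optimal multimarginal transportation plans. -/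
def IsOptimalPlan {m n : ℕ} (C : Tensor m n ℝ) (r : Vecs m n ℝ) (X : Tensor m n ℝ) : Prop :=
  IsPlan r X ∧ ∀ Y, IsPlan r Y → cost C X ≤ cost C Y

/-- `ε`-approximate multimarginal transportation plans. -/
def IsApproxPlan {m n : ℕ} (C : Tensor m n ℝ) (r : Vecs m n ℝ) (ε : ℝ) (X : Tensor m n ℝ) :
    Prop :=
  IsPlan r X ∧ ∃ Xopt, IsOptimalPlan C r Xopt ∧ cost C X ≤ cost C Xopt + ε

end

end MOT

/-! The dual `φ` is a log-sum-exp minus a linear form. Relative to the normalised Gibbs distribution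
at β, the difference φ(γ) - φ(β) is a cumulant generating function minus a linear term (`dual_sub`).
Jensen bounds it below and Hoeffding's lemma above, so φ is convex and smooth with Euclidean
constant m (`dual_convex`, `dual_smooth`). Nesterov's method then brings the dual gap at the
iterates `check` below 2mR²/(t+2)², where R is the Euclidean norm of a minimiser
(`dual_check_sub_le`). The block updates and the search in step 5 only decrease φ, so they do not
disturb this rate.

Conversely, a greedy block update lowers φ by a Kullback–Leibler divergence, hence by at least
E²/(4m²) by Pinsker (`sq_margError_le`). Suppose the residue exceeds τ during 2q + 1 iterations. The
first half brings the gap down to O(mR²/q²), and the second half must fit a total decrease of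
qτ²/(4m²) into it, so q³ = O(m³R²/τ²) (`accResidue_large_bound`). The smoothed marginals are bounded
away from zero, so some minimiser has all entries O(m‖C‖ log n/ε) (`exists_minimiser`), and R² is at
most mn times the square of that. With τ = ε/(16‖C‖) this makes q of order m² n^(1/3) (‖C‖/ε)^(4/3)
(log n)^(2/3). An iteration costs O(m n^m) instructions, because a marginal sums over disjoint
fibres.

For the accuracy, B(β) is optimal for its own marginals up to an entropy term
(`cost_gibbsTensor_le`). Rounding both B(β) and an optimal plan to each other's marginals costs ‖C‖
times the residue in total (`cost_roundTensor_gibbsTensor_le`). The choices of η and ε' make the sum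
of the errors less than ε. -/

namespace MOT

/-! ### Execution of programs -/

section Run

variable {α β : Type}

theorem Prog.run_bind (p : Prog ℝ α) (f : α → Prog ℝ β) :
    (p >>= f).run = ((f p.run.1).run.1, p.run.2 + (f p.run.1).run.2) := by
  change (Prog.bind p f).run = _
  induction p with
  | ret a => simp [Prog.bind, Prog.run]
  | lit c k ih => simp [Prog.bind, Prog.run, ih]; omega
  | un o x k ih => simp [Prog.bind, Prog.run, ih]; omega
  | bin o x y k ih => simp [Prog.bind, Prog.run, ih]; omega
  | cmp x y k ih => simp only [Prog.bind, Prog.run, ih, Prod.mk.injEq, true_and]; omega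

@[simp] theorem Prog.run_bind_fst (p : Prog ℝ α) (f : α → Prog ℝ β) :
    (p >>= f).run.1 = (f p.run.1).run.1 := by rw [Prog.run_bind]

@[simp] theorem Prog.run_bind_snd (p : Prog ℝ α) (f : α → Prog ℝ β) :
    (p >>= f).run.2 = p.run.2 + (f p.run.1).run.2 := by rw [Prog.run_bind]

@[simp] theorem Prog.run_pure (a : α) : (pure a : Prog ℝ α).run = (a, 0) := rfl

@[simp] theorem run_lit (c : ℕ) : (lit c : Prog ℝ ℝ).run = ((c : ℝ), 1) := rfl
@[simp] theorem run_add (x y : ℝ) : (add x y).run = (x + y, 1) := rfl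
@[simp] theorem run_sub (x y : ℝ) : (sub x y).run = (x - y, 1) := rfl
@[simp] theorem run_mul (x y : ℝ) : (mul x y).run = (x * y, 1) := rfl
@[simp] theorem run_div (x y : ℝ) : (div x y).run = (x / y, 1) := rfl
@[simp] theorem run_minimum (x y : ℝ) : (minimum x y).run = (Min.min x y, 1) := rfl
@[simp] theorem run_maximum (x y : ℝ) : (maximum x y).run = (Max.max x y, 1) := rfl
@[simp] theorem run_abs (x : ℝ) : (MOT.abs x).run = (|x|, 1) := rfl
@[simp] theorem run_sqrt (x : ℝ) : (MOT.sqrt x).run = (Real.sqrt x, 1) := rfl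
@[simp] theorem run_exp (x : ℝ) : (MOT.exp x).run = (Real.exp x, 1) := rfl
@[simp] theorem run_log (x : ℝ) : (MOT.log x).run = (Real.log x, 1) := rfl
@[simp] theorem run_compare (x y : ℝ) :
    (MOT.compare x y).run = (if x < y then .lt else if x = y then .eq else .gt, 1) := rfl

theorem run_tabulateFin (N : ℕ) (f : Fin N → Prog ℝ α) :
    (tabulateFin N f).run = (fun i => (f i).run.1, ∑ i, (f i).run.2) := by
  induction N with
  | zero =>
    simp only [tabulateFin, Prog.run_pure, Finset.univ_eq_empty, Finset.sum_empty, Prod.mk.injEq,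
      and_true]
    exact funext fun i => i.elim0
  | succ N ih =>
    simp only [tabulateFin, Prog.run_bind, ih, Prog.run_pure, Fin.sum_univ_succ, add_zero,
      Prod.mk.injEq, and_true]
    funext i
    refine Fin.cases ?_ (fun j => ?_) i <;> simp

variable {ι : Type} [Fintype ι]

@[simp] theorem run_tabulate (f : ι → Prog ℝ α) :
    (tabulate f).run = (fun i => (f i).run.1, ∑ i, (f i).run.2) := by
  simp only [tabulate, Prog.run_bind, run_tabulateFin, Prog.run_pure, Equiv.symm_apply_apply,
    add_zero, Prod.mk.injEq, true_and]
  exact Equiv.sum_comp (Fintype.equivFin ι).symm fun i => (f i).run.2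

@[simp] theorem run_sumList (l : List ℝ) : (sumList l).run = (l.sum, l.length + 1) := by
  induction l with
  | nil => simp [sumList]
  | cons x l ih => simp [sumList, Prog.run_bind, ih]

@[simp] theorem run_prodList (l : List ℝ) : (prodList l).run = (l.prod, l.length + 1) := by
  induction l with
  | nil => simp [prodList]
  | cons x l ih => simp [prodList, Prog.run_bind, ih]

@[simp] theorem run_sum (x : ι → ℝ) : (MOT.sum x).run = (∑ i, x i, Fintype.card ι + 1) := by
  simp [MOT.sum]

@[simp] theorem run_norm1 (x : ι → ℝ) :
    (norm1 x).run = (∑ i, |x i|, 2 * Fintype.card ι + 1) := by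
  simp [norm1, Prog.run_bind]; omega

theorem run_maxList_snd (l : List ℝ) : (maxList l).run.2 = l.length + 1 := by
  induction l with
  | nil => simp [maxList]
  | cons x l ih => simp [maxList, ih]

/-- The fold starts from 0, so it finds the largest entry only when that entry is nonnegative;
`normInf` applies it to absolute values. -/
theorem run_maxList_fst (l : List ℝ) (M : ℝ) (h0 : 0 ≤ M) (hle : ∀ x ∈ l, x ≤ M)
    (hM : M = 0 ∨ M ∈ l) : (maxList l).run.1 = M := by
  have upper : ∀ l : List ℝ, ∀ M : ℝ, 0 ≤ M → (∀ x ∈ l, x ≤ M) → (maxList l).run.1 ≤ M := by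
    intro l
    induction l with
    | nil => intro M h0 _; simpa [maxList] using h0
    | cons x l ih =>
      intro M h0 h
      simp only [maxList, Prog.run_bind_fst, run_maximum]
      exact max_le (h x (by simp)) (ih M h0 fun y hy => h y (by simp [hy]))
  have lower : ∀ l : List ℝ, 0 ≤ (maxList l).run.1 ∧ ∀ x ∈ l, x ≤ (maxList l).run.1 := by
    intro l
    induction l with
    | nil => simp [maxList]
    | cons x l ih =>
      simp only [maxList, Prog.run_bind_fst, run_maximum, List.mem_cons, forall_eq_or_imp]
      exact ⟨le_max_of_le_right ih.1, le_max_left _ _, fun y hy => le_max_of_le_right (ih.2 y hy)⟩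
  refine le_antisymm (upper l M h0 hle) ?_
  rcases hM with rfl | hM
  · exact (lower l).1
  · exact (lower l).2 M hM

theorem run_normInf [Nonempty ι] (x : ι → ℝ) :
    (normInf x).run = (‖x‖, 2 * Fintype.card ι + 1) := by
  have h2 : (normInf x).run.2 = 2 * Fintype.card ι + 1 := by
    simp [normInf, run_maxList_snd]; omega
  have h1 : (normInf x).run.1 = ‖x‖ := by
    simp only [normInf, Prog.run_bind_fst, run_tabulate, run_abs]
    refine run_maxList_fst _ _ (norm_nonneg _) ?_ (Or.inr ?_)
    · intro y hy
      simp only [List.mem_map, Finset.mem_toList, Finset.mem_univ, true_and] at hy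
      obtain ⟨i, rfl⟩ := hy
      exact norm_le_pi_norm x i
    · obtain ⟨i, -, hi⟩ := Finset.exists_mem_eq_sup Finset.univ Finset.univ_nonempty
        fun i => ‖x i‖₊
      replace hi : |x i| = ‖x‖ := by
        rw [Pi.norm_def, hi]; rfl
      simp only [List.mem_map, Finset.mem_toList, Finset.mem_univ, true_and]
      exact ⟨i, hi⟩
  exact Prod.ext h1 h2

end Run

/-! ### The quantities computed by the algorithm -/

noncomputable section

variable {m n : ℕ}

/-- The `k`-th marginal of a tensor. -/
def marg (A : Tensor m n ℝ) (k : Fin m) (j : Fin n) : ℝ :=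
  ∑ i ∈ Finset.univ.filter (fun i : Fin m → Fin n => i k = j), A i

/-- The tensor `B(β)`. -/
def gibbsTensor (C : Tensor m n ℝ) (η : ℝ) (β : Vecs m n ℝ) : Tensor m n ℝ :=
  fun i => Real.exp (∑ k, β k (i k) - C i / η)

/-- The total mass of `B(β)`. -/
def gibbsMass (C : Tensor m n ℝ) (η : ℝ) (β : Vecs m n ℝ) : ℝ := ∑ i, gibbsTensor C η β i

/-- The dual objective `φ`. -/
def dual (C : Tensor m n ℝ) (η : ℝ) (r β : Vecs m n ℝ) : ℝ :=
  Real.log (gibbsMass C η β) - ∑ k, ∑ j, β k j * r k j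

/-- The generalised relative entropy `ρ`. -/
def relEntropy (a b : Fin n → ℝ) : ℝ :=
  ∑ j, (b j - a j) + ∑ j, a j * Real.log (a j / b j)

/-- The block update. -/
def updateBlock (C : Tensor m n ℝ) (η : ℝ) (r : Vecs m n ℝ) (K : Fin m) (β : Vecs m n ℝ) :
    Vecs m n ℝ :=
  Function.update β K fun j =>
    β K j + Real.log (r K j) - Real.log (marg (gibbsTensor C η β) K j)

/-- The total `ℓ¹`-distance of the marginals of a tensor to given vectors. -/
def margError (r : Vecs m n ℝ) (A : Tensor m n ℝ) : ℝ := ∑ k, ∑ j, |marg A k j - r k j|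

theorem gibbsTensor_pos (C : Tensor m n ℝ) (η : ℝ) (β : Vecs m n ℝ) (i : Fin m → Fin n) :
    0 < gibbsTensor C η β i := Real.exp_pos _

/-- The fibres i_k = j partition the index set. This is why a marginal costs about n^m additions and
not n · n^m. -/
theorem sum_card_filter_eq (k : Fin m) :
    ∑ j : Fin n, (Finset.univ.filter fun i : Fin m → Fin n => i k = j).card = n ^ m := by
  rw [← Finset.card_eq_sum_card_fiberwise (fun _ _ => Finset.mem_coe.2 (Finset.mem_univ _))]
  simp

/-! ### Values and instruction counts of the subroutines -/

@[simp] theorem run_marginal (A : Tensor m n ℝ) (k : Fin m) :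
    (marginal A k).run = (marg A k, n ^ m + n) := by
  simp only [marginal, run_tabulate, run_sumList, Finset.sum_map_toList, List.length_map,
    Finset.length_toList, Finset.sum_add_distrib, sum_card_filter_eq]
  simp [marg, funext_iff]

@[simp] theorem run_marginals (A : Tensor m n ℝ) :
    (marginals A).run = (marg A, m * (n ^ m + n)) := by
  simp [marginals]

@[simp] theorem run_gibbs (C : Tensor m n ℝ) (η : ℝ) (β : Vecs m n ℝ) :
    (gibbs C η β).run = (gibbsTensor C η β, n ^ m * (m + 4)) := by
  simp only [gibbs, run_tabulate, Prog.run_bind, run_sum, run_div, run_sub, run_exp]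
  simp [gibbsTensor, funext_iff]

@[simp] theorem run_dualObj (C : Tensor m n ℝ) (η : ℝ) (r β : Vecs m n ℝ) :
    (dualObj C η r β).run =
      (dual C η r β, n ^ m * (m + 4) + (2 * n ^ m + 1) + m * (2 * n + 1) + m + 3) := by
  simp only [dualObj, run_tabulate, Prog.run_bind, run_sum, run_gibbs, run_norm1, run_sub,
    run_mul, run_log, Prod.mk.injEq]
  constructor
  · simp [dual, gibbsMass, abs_of_pos (gibbsTensor_pos _ _ _ _)]
  · simp; ring

@[simp] theorem run_rho (a b : Fin n → ℝ) :
    (rho a b).run = (relEntropy a b, 6 * n + 3) := by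
  simp only [rho, run_tabulate, Prog.run_bind, run_sum, run_sub, run_div, run_add,
    run_mul, run_log, Prod.mk.injEq]
  constructor
  · simp [relEntropy]
  · simp; ring

@[simp] theorem run_blockUpdate (C : Tensor m n ℝ) (η : ℝ) (r : Vecs m n ℝ) (K : Fin m)
    (β : Vecs m n ℝ) :
    (blockUpdate C η r K β).run =
      (updateBlock C η r K β, n ^ m * (m + 4) + (n ^ m + n) + 4 * n) := by
  simp only [blockUpdate, run_tabulate, Prog.run_bind, run_gibbs, run_marginal, run_sub,
    run_add, run_log, Prog.run_pure, Prod.mk.injEq]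
  constructor
  · rfl
  · simp; ring

@[simp] theorem run_residue (r : Vecs m n ℝ) (B : Tensor m n ℝ) :
    (residue r B).run =
      (margError r B, m * (n ^ m + n) + m * (3 * n + 1) + m + 1) := by
  simp only [residue, run_tabulate, Prog.run_bind, run_marginals, run_norm1, run_sub,
    run_sum, Prod.mk.injEq]
  constructor
  · rfl
  · simp; ring

/-- The starting index is arbitrary so that the induction can follow the current best index. A tie
only moves between indices of equal value, so the tie rule does not affect maximality. -/
theorem run_argmax_aux (tie : Fin m → Bool) (v : Fin m → ℝ) (l : List (Fin m)) (k₀ : Fin m) :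
    let p : Prog ℝ (Fin m) := l.foldlM
      (fun best k => do
        match ← compare (v best) (v k) with
        | .lt => pure k
        | .eq => pure (if tie k then k else best)
        | .gt => pure best) k₀
    p.run.2 = l.length ∧ v k₀ ≤ v p.run.1 ∧ ∀ k ∈ l, v k ≤ v p.run.1 := by
  induction l generalizing k₀ with
  | nil => simp
  | cons x l ih =>
    simp only [List.foldlM_cons, Prog.run_bind_snd, Prog.run_bind_fst, run_compare] at ih ⊢
    rcases lt_trichotomy (v k₀) (v x) with h | h | h
    · simp only [h, if_true, Prog.run_pure]
      obtain ⟨h1, h2, h3⟩ := ih x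
      refine ⟨by rw [h1, List.length_cons]; omega, h.le.trans h2, ?_⟩
      simpa using ⟨h2, h3⟩
    · simp only [h, lt_irrefl, if_true, if_false, Prog.run_pure]
      obtain ⟨h1, h2, h3⟩ := ih (if tie x then x else k₀)
      have hx : v (if tie x then x else k₀) = v x := by split_ifs <;> simp [h]
      rw [hx] at h2
      refine ⟨by rw [h1, List.length_cons]; omega, h2, ?_⟩
      simpa using ⟨h2, h3⟩
    · simp only [h.not_gt, h.ne', if_false, Prog.run_pure]
      obtain ⟨h1, h2, h3⟩ := ih k₀
      refine ⟨by rw [h1, List.length_cons]; omega, h2, ?_⟩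
      simpa using ⟨h.le.trans h2, h3⟩

theorem run_argmax_snd (tie : Fin m → Bool) (k₀ : Fin m) (v : Fin m → ℝ) :
    (argmax tie k₀ v).run.2 = m := by
  exact (run_argmax_aux tie v (List.finRange m) k₀).1.trans (List.length_finRange)

theorem le_run_argmax (tie : Fin m → Bool) (k₀ : Fin m) (v : Fin m → ℝ) (k : Fin m) :
    v k ≤ v (argmax tie k₀ v).run.1 :=
  (run_argmax_aux tie v (List.finRange m) k₀).2.2 k (List.mem_finRange k)

/-! ### One iteration of the accelerated algorithm -/

/-- The extrapolated point `β̄`. -/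
def AccState.bar (s : AccState m n ℝ) : Vecs m n ℝ :=
  fun k j => (1 - s.θ) * s.check k j + s.θ * s.tilde k j

/-- The gradient of the dual objective. -/
def dualGrad (C : Tensor m n ℝ) (η : ℝ) (r β : Vecs m n ℝ) : Vecs m n ℝ :=
  fun k j => marg (gibbsTensor C η β) k j / gibbsMass C η β - r k j

/-- The gradient step `β̃^{t+1}`. -/
def AccState.nextTilde (C : Tensor m n ℝ) (η : ℝ) (r : Vecs m n ℝ) (s : AccState m n ℝ) :
    Vecs m n ℝ :=
  fun k j => s.tilde k j - 1 / (m * s.θ) * dualGrad C η r s.bar k j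

/-- The point `β̀`. -/
def AccState.grave (C : Tensor m n ℝ) (η : ℝ) (r : Vecs m n ℝ) (s : AccState m n ℝ) :
    Vecs m n ℝ :=
  fun k j => s.bar k j + s.θ * (s.nextTilde C η r k j - s.tilde k j)

/-- The point `β̂`. -/
def AccState.hat (C : Tensor m n ℝ) (η : ℝ) (r : Vecs m n ℝ) (s : AccState m n ℝ) :
    Vecs m n ℝ :=
  updateBlock C η r s.K (s.grave C η r)

/-- The result of the monotone search step. -/
def AccState.best (keep : Bool) (C : Tensor m n ℝ) (η : ℝ) (r : Vecs m n ℝ)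
    (s : AccState m n ℝ) : Vecs m n ℝ :=
  if dual C η r s.check < dual C η r (s.hat C η r) then s.check
  else if dual C η r s.check = dual C η r (s.hat C η r) then
    if keep then s.check else s.hat C η r
  else s.hat C η r

theorem run_accFirstHalf_fst (tie : TieRule m) (C : Tensor m n ℝ) (η : ℝ) (r : Vecs m n ℝ)
    (t : ℕ) (s : AccState m n ℝ) :
    (accFirstHalf tie C η r t s).run.1 =
      (s.nextTilde C η r, s.best (tie.keep t) C η r) := by
  have hM : ∀ β, ∑ i, |gibbsTensor C η β i| = gibbsMass C η β := fun β =>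
    Finset.sum_congr rfl fun i _ => abs_of_pos (gibbsTensor_pos _ _ _ _)
  have hbar : (fun (k : Fin m) (j : Fin n) =>
      (1 - s.θ) * s.check k j + s.θ * s.tilde k j) = s.bar := rfl
  have htil : (fun (k : Fin m) (j : Fin n) => s.tilde k j - 1 / (m * s.θ) *
      (marg (gibbsTensor C η s.bar) k j / gibbsMass C η s.bar - r k j)) = s.nextTilde C η r := rfl
  have hgr : (fun (k : Fin m) (j : Fin n) => s.bar k j + s.θ *
      (s.nextTilde C η r k j - s.tilde k j)) = s.grave C η r := rfl
  have hhat : updateBlock C η r s.K (s.grave C η r) = s.hat C η r := rfl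
  simp only [accFirstHalf, Prog.run_bind_fst, run_lit, run_sub, run_tabulate, run_mul, run_add,
    run_gibbs, run_norm1, run_marginals, run_div, run_blockUpdate, run_dualObj, run_compare, hM,
    Nat.cast_one, hbar, htil, hgr, hhat, Prog.run_pure, AccState.best, Prod.mk.injEq, true_and]
  by_cases h1 : dual C η r s.check < dual C η r (s.hat C η r)
  · simp [h1]
  · by_cases h2 : dual C η r s.check = dual C η r (s.hat C η r)
    · simp [h2]
    · simp [h1, h2]

theorem run_accFirstHalf_snd (tie : TieRule m) (C : Tensor m n ℝ) (η : ℝ) (r : Vecs m n ℝ)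
    (t : ℕ) (s : AccState m n ℝ) (hm : 2 ≤ m) (hn : 2 ≤ n) :
    (accFirstHalf tie C η r t s).run.2 ≤ 100 * (m * n ^ m) := by
  have key : (accFirstHalf tie C η r t s).run.2 =
      2 + m * (n * 3) + n ^ m * (m + 4) + (2 * n ^ m + 1) + m * (n ^ m + n) + 3 + m * (n * 4)
        + m * (n * 3) + (n ^ m * (m + 4) + (n ^ m + n) + 4 * n)
        + 2 * (n ^ m * (m + 4) + (2 * n ^ m + 1) + m * (2 * n + 1) + m + 3) + 1 := by
    simp only [accFirstHalf, Prog.run_bind_snd, Prog.run_bind_fst, run_lit, run_sub, run_tabulate,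
      run_mul, run_add, run_gibbs, run_norm1, run_marginals, run_div, run_blockUpdate,
      run_dualObj, run_compare, Prog.run_pure, Finset.sum_const, Finset.card_univ,
      Fintype.card_fin, smul_eq_mul, Fintype.card_pi_const]
    split <;> simp only [Prog.run_pure] <;> ring
  -- Each of 1, m, n, mn and n^m is at most m n^m, so the exact count is a bounded multiple of m
  -- n^m; 100 is generous.
  have hnN : n ≤ n ^ m := Nat.le_self_pow (by omega) n
  have h1 : 1 ≤ n ^ m := by omega
  have hmn : m * n ≤ m * n ^ m := Nat.mul_le_mul_left _ hnN
  have hN : n ^ m ≤ m * n ^ m := Nat.le_mul_of_pos_left _ (by omega)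
  have hmm : m ≤ m * n ^ m := Nat.le_mul_of_pos_right _ (by omega)
  rw [key]
  nlinarith

/-- The greedy coordinate. -/
def greedyCoord (tie : Fin m → Bool) (C : Tensor m n ℝ) (η : ℝ) (r : Vecs m n ℝ) (k₀ : Fin m)
    (β : Vecs m n ℝ) : Fin m :=
  (argmax tie k₀ fun k => relEntropy (r k) (marg (gibbsTensor C η β) k)).run.1

theorem le_greedyCoord (tie : Fin m → Bool) (C : Tensor m n ℝ) (η : ℝ) (r : Vecs m n ℝ)
    (k₀ : Fin m) (β : Vecs m n ℝ) (k : Fin m) :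
    relEntropy (r k) (marg (gibbsTensor C η β) k) ≤
      relEntropy (r (greedyCoord tie C η r k₀ β))
        (marg (gibbsTensor C η β) (greedyCoord tie C η r k₀ β)) :=
  le_run_argmax tie k₀ (fun k => relEntropy (r k) (marg (gibbsTensor C η β) k)) k

/-- The state after iteration `t`. -/
def AccState.next (tie : TieRule m) (C : Tensor m n ℝ) (η : ℝ) (r : Vecs m n ℝ) (k₀ : Fin m)
    (t : ℕ) (s : AccState m n ℝ) : AccState m n ℝ where
  θ := s.θ * (Real.sqrt (s.θ * s.θ + 4) - s.θ) / 2
  K := greedyCoord (tie.coord t) C η r k₀ (s.best (tie.keep t) C η r)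
  check := updateBlock C η r (greedyCoord (tie.coord t) C η r k₀ (s.best (tie.keep t) C η r))
    (s.best (tie.keep t) C η r)
  tilde := s.nextTilde C η r

/-- The states of the accelerated algorithm. -/
def accState (tie : TieRule m) (C : Tensor m n ℝ) (η : ℝ) (r : Vecs m n ℝ) (k₀ : Fin m) :
    ℕ → AccState m n ℝ
  | 0 => { θ := 1, K := k₀, check := fun _ _ => 0, tilde := fun _ _ => 0 }
  | t + 1 => (accState tie C η r k₀ t).next tie C η r k₀ t

/-- The iterates `β^t`. -/
def accIter (tie : TieRule m) (C : Tensor m n ℝ) (η : ℝ) (r : Vecs m n ℝ) (k₀ : Fin m)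
    (t : ℕ) : Vecs m n ℝ :=
  (accState tie C η r k₀ t).best (tie.keep t) C η r

/-- The residues `E_t`. -/
def accResidue (tie : TieRule m) (C : Tensor m n ℝ) (η : ℝ) (r : Vecs m n ℝ) (k₀ : Fin m)
    (t : ℕ) : ℝ :=
  margError r (gibbsTensor C η (accIter tie C η r k₀ t))

theorem run_accSecondHalf_fst (tie : TieRule m) (C : Tensor m n ℝ) (η : ℝ) (r : Vecs m n ℝ)
    (k₀ : Fin m) (t : ℕ) (s : AccState m n ℝ) :
    (accSecondHalf tie C η r k₀ t s (s.nextTilde C η r) (s.best (tie.keep t) C η r)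
      (gibbsTensor C η (s.best (tie.keep t) C η r))).run.1 = s.next tie C η r k₀ t := by
  simp only [accSecondHalf, Prog.run_bind_fst, run_lit, run_sub, run_tabulate, run_mul, run_add,
    run_marginals, run_div, run_blockUpdate, run_rho, run_sqrt, Prog.run_pure]
  simp only [AccState.next, Nat.cast_ofNat, greedyCoord]

theorem run_accSecondHalf_snd (tie : TieRule m) (C : Tensor m n ℝ) (η : ℝ) (r : Vecs m n ℝ)
    (k₀ : Fin m) (t : ℕ) (s : AccState m n ℝ) (x y : Vecs m n ℝ) (B : Tensor m n ℝ)
    (hm : 2 ≤ m) (hn : 2 ≤ n) :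
    (accSecondHalf tie C η r k₀ t s x y B).run.2 ≤ 60 * (m * n ^ m) := by
  have key : (accSecondHalf tie C η r k₀ t s x y B).run.2 =
      m * (n ^ m + n) + m * (6 * n + 3) + m + (n ^ m * (m + 4) + (n ^ m + n) + 4 * n) + 8 := by
    simp only [accSecondHalf, Prog.run_bind_snd, run_lit, run_sub,
      run_tabulate, run_mul, run_add, run_marginals, run_div, run_blockUpdate, run_rho, run_sqrt,
      Prog.run_pure, Finset.sum_const, Finset.card_univ, Fintype.card_fin, smul_eq_mul,
      run_argmax_snd]
    ring
  have hnN : n ≤ n ^ m := Nat.le_self_pow (by omega) n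
  have h1 : 1 ≤ n ^ m := by omega
  have hmn : m * n ≤ m * n ^ m := Nat.mul_le_mul_left _ hnN
  have hN : n ^ m ≤ m * n ^ m := Nat.le_mul_of_pos_left _ (by omega)
  have hmm : m ≤ m * n ^ m := Nat.le_mul_of_pos_right _ (by omega)
  rw [key]
  nlinarith

/-- Fuel `j + 1` pays for `j` failing tests and the successful one. The entry time is quantified
inside the induction because the loop re-enters itself at `t + 1`. -/
theorem run_accLoop (tie : TieRule m) (C : Tensor m n ℝ) (η : ℝ) (r : Vecs m n ℝ) (tol : ℝ)
    (k₀ : Fin m) (hm : 2 ≤ m) (hn : 2 ≤ n) (j : ℕ) : ∀ t : ℕ,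
    (∀ i < j, tol < accResidue tie C η r k₀ (t + i)) → accResidue tie C η r k₀ (t + j) ≤ tol →
    ∃ N, (accLoop tie C η r tol k₀ (j + 1) t (accState tie C η r k₀ t)).run =
        (some (gibbsTensor C η (accIter tie C η r k₀ (t + j))), N) ∧
      N ≤ (j + 1) * (200 * (m * n ^ m)) := by
  have hnN : n ≤ n ^ m := Nat.le_self_pow (by omega) n
  have h1 : 1 ≤ n ^ m := by omega
  have hmn : m * n ≤ m * n ^ m := Nat.mul_le_mul_left _ hnN
  have hN : n ^ m ≤ m * n ^ m := Nat.le_mul_of_pos_left _ (by omega)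
  have hmm : m ≤ m * n ^ m := Nat.le_mul_of_pos_right _ (by omega)
  have hcost : ∀ t : ℕ, (accFirstHalf tie C η r t (accState tie C η r k₀ t)).run.2 +
      (n ^ m * (m + 4) + (m * (n ^ m + n) + m * (3 * n + 1) + m + 1 + 1)) ≤
        120 * (m * n ^ m) := by
    intro t
    have := run_accFirstHalf_snd tie C η r t (accState tie C η r k₀ t) hm hn
    nlinarith
  induction j with
  | zero =>
    intro t _ hdone
    have h := hcost t
    refine ⟨(accFirstHalf tie C η r t (accState tie C η r k₀ t)).run.2 +
      (n ^ m * (m + 4) + (m * (n ^ m + n) + m * (3 * n + 1) + m + 1 + 1)), ?_, by omega⟩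
    have hE : margError r (gibbsTensor C η ((accState tie C η r k₀ t).best (tie.keep t) C η r))
        ≤ tol := hdone
    simp only [accLoop, Prog.run_bind, run_accFirstHalf_fst, run_gibbs, run_residue, run_compare]
    rcases hE.lt_or_eq with hE | hE
    · simp only [hE, if_true, Prog.run_pure]
      rfl
    · simp only [hE, lt_irrefl, if_true, if_false, Prog.run_pure]
      rfl
  | succ j ih =>
    intro t hgo hdone
    have h := hcost t
    have hE : tol <
        margError r (gibbsTensor C η ((accState tie C η r k₀ t).best (tie.keep t) C η r)) := by
      exact hgo 0 (by omega)
    obtain ⟨N, hrun, hle⟩ := ih (t + 1)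
      (fun i hi => by simpa [add_assoc, add_comm 1] using hgo (i + 1) (by omega))
      (by simpa [add_assoc, add_comm 1] using hdone)
    have h2 := run_accSecondHalf_snd tie C η r k₀ t (accState tie C η r k₀ t)
      ((accState tie C η r k₀ t).nextTilde C η r)
      ((accState tie C η r k₀ t).best (tie.keep t) C η r)
      (gibbsTensor C η ((accState tie C η r k₀ t).best (tie.keep t) C η r)) hm hn
    have hst : (accState tie C η r k₀ t).next tie C η r k₀ t = accState tie C η r k₀ (t + 1) := rfl
    refine ⟨(accFirstHalf tie C η r t (accState tie C η r k₀ t)).run.2 +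
      (n ^ m * (m + 4) + (m * (n ^ m + n) + m * (3 * n + 1) + m + 1 + (1 +
        ((accSecondHalf tie C η r k₀ t (accState tie C η r k₀ t)
          ((accState tie C η r k₀ t).nextTilde C η r)
          ((accState tie C η r k₀ t).best (tie.keep t) C η r)
          (gibbsTensor C η ((accState tie C η r k₀ t).best (tie.keep t) C η r))).run.2 + N)))),
      ?_, ?_⟩
    · rw [accLoop]
      simp only [Prog.run_bind, run_accFirstHalf_fst, run_gibbs, run_residue, run_compare,
        hE.not_gt, hE.ne', if_false, run_accSecondHalf_fst, hst, hrun]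
      rw [show t + 1 + j = t + (j + 1) by omega]
    · have : (j + 1 + 1) * (200 * (m * n ^ m)) =
          (j + 1) * (200 * (m * n ^ m)) + 200 * (m * n ^ m) := by ring
      omega

theorem run_accSinkhorn (tie : TieRule m) (C : Tensor m n ℝ) (η : ℝ) (r : Vecs m n ℝ) (tol : ℝ)
    (k₀ : Fin m) (hm : 2 ≤ m) (hn : 2 ≤ n) (T : ℕ)
    (hgo : ∀ i < T, tol < accResidue tie C η r k₀ i) (hdone : accResidue tie C η r k₀ T ≤ tol) :
    ∃ N, (accSinkhorn tie C η r tol k₀ (T + 1)).run =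
        (some (gibbsTensor C η (accIter tie C η r k₀ T)), N) ∧
      N ≤ (T + 1) * (200 * (m * n ^ m)) + 2 := by
  obtain ⟨N, hrun, hle⟩ := run_accLoop tie C η r tol k₀ hm hn T 0 (by simpa using hgo)
    (by simpa using hdone)
  refine ⟨1 + (1 + N), ?_, by omega⟩
  have h0 : accState tie C η r k₀ 0 =
    { θ := 1, K := k₀, check := fun _ _ => 0, tilde := fun _ _ => 0 } := rfl
  rw [h0, zero_add] at hrun
  simp only [accSinkhorn, Prog.run_bind, run_lit, Nat.cast_one, Nat.cast_zero, hrun]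

/-! ### Rounding -/

/-- Scaling along the `k`-th direction so that the `k`-th marginal becomes at most `r k`. -/
def scaleMarginal (r : Vecs m n ℝ) (X : Tensor m n ℝ) (k : Fin m) : Tensor m n ℝ :=
  fun i => Min.min 1 (r k (i k) / marg X k (i k)) * X i

/-- Scaling along all directions. -/
def scaleMarginals (r : Vecs m n ℝ) (X : Tensor m n ℝ) : Tensor m n ℝ :=
  (List.finRange m).foldl (scaleMarginal r) X

/-- The rounding of a tensor. -/
def roundTensor (r : Vecs m n ℝ) (k₀ : Fin m) (X : Tensor m n ℝ) : Tensor m n ℝ :=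
  fun i => scaleMarginals r X i +
    (∏ k, (r k (i k) - marg (scaleMarginals r X) k (i k))) /
      (∑ j, |r k₀ j - marg (scaleMarginals r X) k₀ j|) ^ (m - 1)

theorem run_foldlM {α β : Type} (f : α → β → Prog ℝ α) (g : α → β → α) (c : ℕ)
    (h : ∀ a b, (f a b).run = (g a b, c)) (l : List β) (a : α) :
    (l.foldlM f a).run = (l.foldl g a, l.length * c) := by
  induction l generalizing a with
  | nil => simp
  | cons x l ih => simp [List.foldlM_cons, Prog.run_bind, h, ih]; ring

theorem run_round (X : Tensor m n ℝ) (r : Vecs m n ℝ) (k₀ : Fin m) (hm : 2 ≤ m) (hn : 2 ≤ n) :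
    ∃ N, (round X r k₀).run = (roundTensor r k₀ X, N) ∧ N ≤ 60 * (m * n ^ m) := by
  have hnN : n ≤ n ^ m := Nat.le_self_pow (by omega) n
  have h1 : 1 ≤ n ^ m := by omega
  have hmn : m * n ≤ m * n ^ m := Nat.mul_le_mul_left _ hnN
  have hN : n ^ m ≤ m * n ^ m := Nat.le_mul_of_pos_left _ (by omega)
  have hmm : m ≤ m * n ^ m := Nat.le_mul_of_pos_right _ (by omega)
  have hfold := run_foldlM
    (fun (X : Tensor m n ℝ) (k : Fin m) => do
      let q ← marginal X k
      let z ← tabulate fun j => do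
        let a ← div (r k j) (q j)
        minimum (1 : ℝ) a
      tabulate fun i => mul (z (i k)) (X i)) (scaleMarginal r) (n ^ m + n + (n * 2 + n ^ m))
    (by
      intro X k
      simp only [Prog.run_bind, run_marginal, run_tabulate, run_div, run_minimum, run_mul,
        Prod.mk.injEq]
      constructor
      · rfl
      · simp)
    (List.finRange m) X
  refine ⟨1 + (m * (n ^ m + n + (n * 2 + n ^ m)) + (m * (n ^ m + n) + (m * n + (2 * n + 1 +
    (m - 1 + 1 + n ^ m * (m + 1 + 2)))))), ?_, ?_⟩
  · rw [round]
    simp only [Prog.run_bind, run_lit, Nat.cast_one, hfold, run_marginals, run_tabulate, run_div,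
      run_norm1, run_prodList, run_sub, run_add, List.prod_replicate, List.length_replicate,
      List.length_map, List.length_finRange, Prod.mk.injEq]
    constructor
    · funext i
      simp [roundTensor, scaleMarginals, Fin.prod_univ_def]
    · simp
  · have : m - 1 ≤ m := Nat.sub_le _ _
    nlinarith

/-! ### The complete algorithm -/

/-- The marginals, moved towards the uniform distribution. -/
def smoothMarginals (δ : ℝ) (r : Vecs m n ℝ) : Vecs m n ℝ :=
  fun k j => (1 - δ / (4 * m)) * r k j + δ / (4 * m * n)

/-- Here `T` is the first iteration that passes the test. Preparation and rounding cost O(m n^m),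
which is absorbed by raising the cost per iteration from 200 to 300, since T + 1 ≥ 1. -/
theorem returns_approxMOT (tie : TieRule m) (C : Tensor m n ℝ) (r : Vecs m n ℝ) (ε : ℝ)
    (k₀ : Fin m) (hm : 2 ≤ m) (hn : 2 ≤ n) (η δ : ℝ) (hη : η = ε / (2 * m * Real.log n))
    (hδ : δ = ε / (8 * ‖C‖)) (T : ℕ)
    (hgo : ∀ i < T, δ / 2 < accResidue tie C η (smoothMarginals δ r) k₀ i)
    (hdone : accResidue tie C η (smoothMarginals δ r) k₀ T ≤ δ / 2) :
    ∃ N, Returns (approxMOT tie C r ε k₀)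
        (roundTensor r k₀ (gibbsTensor C η (accIter tie C η (smoothMarginals δ r) k₀ T))) N ∧
      N ≤ (T + 1) * (300 * (m * n ^ m)) := by
  obtain ⟨N₁, hrun₁, hle₁⟩ :=
    run_accSinkhorn tie C η (smoothMarginals δ r) (δ / 2) k₀ hm hn T hgo hdone
  obtain ⟨N₂, hrun₂, hle₂⟩ := run_round
    (gibbsTensor C η (accIter tie C η (smoothMarginals δ r) k₀ T)) r k₀ hm hn
  have : Nonempty (Fin m → Fin n) := ⟨fun _ => ⟨0, by omega⟩⟩
  have hs : (fun (k : Fin m) (j : Fin n) => (1 - δ / (4 * m)) * r k j + δ / (4 * m * n)) =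
    smoothMarginals δ r := rfl
  refine ⟨10 + (2 * n ^ m + 1) + 7 + m * (n * 2) + 1 + N₁ + N₂, ⟨T + 1, ?_⟩, ?_⟩
  · simp only [approxMOT, Prog.run_bind, run_lit, run_log, run_mul, run_div, run_normInf, run_sub,
      run_add, run_tabulate, Nat.cast_one, Nat.cast_ofNat, ← hη, ← hδ, hs, hrun₁, hrun₂,
      Prog.run_pure, Finset.sum_const, Finset.card_univ, Fintype.card_fin, smul_eq_mul,
      Fintype.card_pi_const, Prod.mk.injEq, true_and]
    ring
  · have hnN : n ≤ n ^ m := Nat.le_self_pow (by omega) n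
    have h1 : 1 ≤ n ^ m := by omega
    have hmn : m * n ≤ m * n ^ m := Nat.mul_le_mul_left _ hnN
    have hN : n ^ m ≤ m * n ^ m := Nat.le_mul_of_pos_left _ (by omega)
    nlinarith

end

/-! ### Relative entropy and Hoeffding's lemma on finite sets -/

/-- This is log u ≤ u - 1 at u = √(b/a), multiplied by -2a. The squared difference of roots, summed,
is a Hellinger distance and yields Pinsker; without it the bound is Gibbs' inequality. -/
theorem mul_log_div_ge {a b : ℝ} (ha : 0 ≤ a) (hb : 0 < b) :
    (a - b) + (Real.sqrt a - Real.sqrt b) ^ 2 ≤ a * Real.log (a / b) := by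
  rcases ha.eq_or_lt with rfl | ha
  · simp [Real.sq_sqrt hb.le]
  have hsa := Real.sqrt_pos.2 ha
  have hsb := Real.sqrt_pos.2 hb
  have h1 := Real.log_le_sub_one_of_pos (div_pos hsb hsa)
  have h2 : Real.log (a / b) = -2 * Real.log (Real.sqrt b / Real.sqrt a) := by
    rw [Real.log_div ha.ne' hb.ne', Real.log_div hsb.ne' hsa.ne', Real.log_sqrt ha.le,
      Real.log_sqrt hb.le]
    ring
  have h3 : a * (Real.sqrt b / Real.sqrt a) = Real.sqrt a * Real.sqrt b := by
    nth_rewrite 1 [← Real.mul_self_sqrt ha.le]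
    field_simp
  have h4 := mul_le_mul_of_nonneg_left h1 ha.le
  rw [h2]
  nlinarith [Real.sq_sqrt ha.le, Real.sq_sqrt hb.le]

/-- A weak form of Pinsker's inequality. -/
theorem sq_sum_abs_le_entropy {ι : Type*} [Fintype ι] (a b : ι → ℝ) (ha : ∀ i, 0 ≤ a i)
    (hb : ∀ i, 0 < b i) (hsa : ∑ i, a i = 1) (hsb : ∑ i, b i = 1) :
    (∑ i, |b i - a i|) ^ 2 ≤ 4 * ∑ i, a i * Real.log (a i / b i) := by
  have h1 : ∑ i, (Real.sqrt (a i) - Real.sqrt (b i)) ^ 2 ≤ ∑ i, a i * Real.log (a i / b i) := by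
    have := Finset.sum_le_sum fun i (_ : i ∈ Finset.univ) => mul_log_div_ge (ha i) (hb i)
    rw [Finset.sum_add_distrib, Finset.sum_sub_distrib, hsa, hsb] at this
    linarith
  have h2 : ∑ i, (Real.sqrt (a i) + Real.sqrt (b i)) ^ 2 ≤ 4 := by
    calc ∑ i, (Real.sqrt (a i) + Real.sqrt (b i)) ^ 2 ≤ ∑ i, 2 * (a i + b i) := by
          refine Finset.sum_le_sum fun i _ => ?_
          nlinarith [Real.sq_sqrt (ha i), Real.sq_sqrt (hb i).le,
            sq_nonneg (Real.sqrt (a i) - Real.sqrt (b i))]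
      _ = 4 := by rw [← Finset.mul_sum, Finset.sum_add_distrib, hsa, hsb]; norm_num
  -- Factoring a - b = (√a - √b)(√a + √b) and applying Cauchy–Schwarz bounds the ℓ¹ distance by the
  -- Hellinger distance.
  have h3 : ∑ i, |b i - a i| =
      ∑ i, |Real.sqrt (a i) - Real.sqrt (b i)| * (Real.sqrt (a i) + Real.sqrt (b i)) := by
    refine Finset.sum_congr rfl fun i _ => ?_
    rw [← abs_of_nonneg (add_nonneg (Real.sqrt_nonneg (a i)) (Real.sqrt_nonneg (b i))), ← abs_mul,
      abs_sub_comm]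
    congr 1
    nlinarith [Real.sq_sqrt (ha i), Real.sq_sqrt (hb i).le]
  have h4 := Finset.sum_mul_sq_le_sq_mul_sq Finset.univ
    (fun i => |Real.sqrt (a i) - Real.sqrt (b i)|) fun i => Real.sqrt (a i) + Real.sqrt (b i)
  simp only [sq_abs] at h4
  rw [h3]
  have h5 : 0 ≤ ∑ i, (Real.sqrt (a i) - Real.sqrt (b i)) ^ 2 :=
    Finset.sum_nonneg fun i _ => sq_nonneg _
  nlinarith

/-- Hoeffding's lemma for finitely supported random variables. -/
theorem sum_mul_exp_le {ι : Type*} [Fintype ι] (p d : ι → ℝ) (D : ℝ) (hp : ∀ i, 0 ≤ p i)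
    (hsum : ∑ i, p i = 1) (hd : ∀ i, |d i| ≤ D) :
    ∑ i, p i * Real.exp (d i) ≤ Real.exp (∑ i, p i * d i + D ^ 2 / 2) := by
  let : MeasurableSpace ι := ⊤
  have hone : ∑ i, ENNReal.ofReal (p i) = 1 := by
    rw [← ENNReal.ofReal_sum_of_nonneg fun i _ => hp i, hsum, ENNReal.ofReal_one]
  let q : PMF ι := PMF.ofFintype (fun i => ENNReal.ofReal (p i)) hone
  have hq : ∀ f : ι → ℝ, ∫ i, f i ∂q.toMeasure = ∑ i, p i * f i := by
    intro f
    rw [PMF.integral_eq_sum]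
    refine Finset.sum_congr rfl fun i _ => ?_
    simp [q, ENNReal.toReal_ofReal (hp i)]
  have hD : 0 ≤ D := by
    by_contra h
    have : IsEmpty ι := ⟨fun i => h ((_root_.abs_nonneg _).trans (hd i))⟩
    simp at hsum
  -- A variable with values in [-D, D] is sub-Gaussian about its mean with variance proxy (2D/2)² =
  -- D²; the moment generating function is taken at 1.
  have h := (ProbabilityTheory.hasSubgaussianMGF_of_mem_Icc (μ := q.toMeasure) (X := d)
    (a := -D) (b := D) (measurable_from_top).aemeasurable
    (Filter.Eventually.of_forall fun i => Set.mem_Icc.2 (abs_le.1 (hd i)))).mgf_le 1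
  rw [ProbabilityTheory.mgf, hq d, hq] at h
  have hc : (((‖D - -D‖₊ / 2) ^ 2 : NNReal) : ℝ) = D ^ 2 := by
    simp [show D + D = 2 * D by ring]
  rw [hc] at h
  simp only [one_mul, Real.exp_sub, one_pow, mul_one] at h
  rw [Real.exp_add, mul_comm]
  have hE := Real.exp_pos (∑ i, p i * d i)
  simp only [← mul_div_assoc, ← Finset.sum_div] at h
  rwa [div_le_iff₀ hE] at h

/-! ### Marginals -/

section Marginals

variable {m n : ℕ}

theorem sum_marg_mul (A : Tensor m n ℝ) (k : Fin m) (f : Fin n → ℝ) :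
    ∑ j, marg A k j * f j = ∑ i, A i * f (i k) := by
  rw [← Finset.sum_fiberwise Finset.univ fun i : Fin m → Fin n => i k]
  refine Finset.sum_congr rfl fun j _ => ?_
  rw [marg, Finset.sum_mul]
  refine Finset.sum_congr rfl fun i hi => ?_
  rw [(Finset.mem_filter.1 hi).2]

theorem sum_marg (A : Tensor m n ℝ) (k : Fin m) : ∑ j, marg A k j = ∑ i, A i := by
  simpa using sum_marg_mul A k fun _ => 1

theorem marg_nonneg {A : Tensor m n ℝ} (hA : ∀ i, 0 ≤ A i) (k : Fin m) (j : Fin n) :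
    0 ≤ marg A k j := Finset.sum_nonneg fun i _ => hA i

theorem marg_pos {A : Tensor m n ℝ} (hA : ∀ i, 0 < A i) (k : Fin m) (j : Fin n) :
    0 < marg A k j :=
  Finset.sum_pos (fun i _ => hA i) ⟨fun _ => j, by simp⟩

theorem le_marg {A : Tensor m n ℝ} (hA : ∀ i, 0 ≤ A i) (k : Fin m) (i : Fin m → Fin n) :
    A i ≤ marg A k (i k) :=
  Finset.single_le_sum (f := A) (fun i _ => hA i) (by simp)

theorem marg_mono {A B : Tensor m n ℝ} (h : ∀ i, A i ≤ B i) (k : Fin m) (j : Fin n) :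
    marg A k j ≤ marg B k j := Finset.sum_le_sum fun i _ => h i

theorem marg_add (A B : Tensor m n ℝ) (k : Fin m) (j : Fin n) :
    marg (fun i => A i + B i) k j = marg A k j + marg B k j := Finset.sum_add_distrib

theorem sum_prod_tensor (f : Fin m → Fin n → ℝ) :
    ∑ i : Fin m → Fin n, ∏ k, f k (i k) = ∏ k, ∑ j, f k j := by
  rw [Finset.prod_univ_sum, Fintype.piFinset_univ]

/-- Fixing i_K = j restricts the index set to a product of a singleton and full ranges, and the sum
of products factors over it. -/
theorem marg_prod (f : Fin m → Fin n → ℝ) (K : Fin m) (j : Fin n) :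
    marg (fun i => ∏ k, f k (i k)) K j = f K j * ∏ k ∈ Finset.univ.erase K, ∑ l, f k l := by
  have h := Finset.prod_univ_sum
    (Function.update (fun _ : Fin m => (Finset.univ : Finset (Fin n))) K {j}) f
  rw [← Finset.mul_prod_erase Finset.univ _ (Finset.mem_univ K)] at h
  have hfil : Fintype.piFinset
      (Function.update (fun _ : Fin m => (Finset.univ : Finset (Fin n))) K {j}) =
      Finset.univ.filter fun i : Fin m → Fin n => i K = j := by
    ext i
    simp only [Fintype.mem_piFinset, Finset.mem_filter, Finset.mem_univ, true_and]
    constructor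
    · intro h
      simpa using h K
    · rintro rfl k
      by_cases hk : k = K
      · subst hk; simp
      · simp [hk]
  rw [hfil] at h
  rw [marg, ← h, Function.update_self, Finset.sum_singleton]
  congr 1
  refine Finset.prod_congr rfl fun k hk => ?_
  rw [Function.update_of_ne (Finset.ne_of_mem_erase hk)]

end Marginals

/-! ### The dual objective -/

section Dual

variable {m n : ℕ} (C : Tensor m n ℝ) (η : ℝ) (r : Vecs m n ℝ)

theorem gibbsMass_pos (hn : 0 < n) (β : Vecs m n ℝ) : 0 < gibbsMass C η β :=
  Finset.sum_pos (fun _ _ => gibbsTensor_pos _ _ _ _) ⟨fun _ => ⟨0, hn⟩, Finset.mem_univ _⟩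

theorem gibbsTensor_shift (β γ : Vecs m n ℝ) (i : Fin m → Fin n) :
    gibbsTensor C η γ i = gibbsTensor C η β i * Real.exp (∑ k, (γ k (i k) - β k (i k))) := by
  rw [gibbsTensor, gibbsTensor, ← Real.exp_add, Finset.sum_sub_distrib]
  congr 1
  ring

theorem sum_gibbsTensor_mul (β Δ : Vecs m n ℝ) :
    ∑ i, gibbsTensor C η β i / gibbsMass C η β * ∑ k, Δ k (i k) =
      ∑ k, ∑ j, marg (gibbsTensor C η β) k j / gibbsMass C η β * Δ k j := by
  simp_rw [div_mul_eq_mul_div, ← Finset.sum_div]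
  congr 1
  simp_rw [sum_marg_mul, Finset.mul_sum]
  rw [Finset.sum_comm]

/-- With p = B(β)/‖B(β)‖₁ as a probability on indices, the logarithm is the cumulant generating
function of i ↦ ∑_k (γ - β)_{k,i_k}. Convexity, smoothness and shift invariance of φ are all read
off from this. -/
theorem dual_sub (hn : 0 < n) (β γ : Vecs m n ℝ) :
    dual C η r γ - dual C η r β =
      Real.log (∑ i, gibbsTensor C η β i / gibbsMass C η β *
        Real.exp (∑ k, (γ k (i k) - β k (i k)))) - ∑ k, ∑ j, (γ k j - β k j) * r k j := by
  have hM := gibbsMass_pos C η hn β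
  have h : ∑ i, gibbsTensor C η β i / gibbsMass C η β *
      Real.exp (∑ k, (γ k (i k) - β k (i k))) = gibbsMass C η γ / gibbsMass C η β := by
    simp_rw [div_mul_eq_mul_div, ← Finset.sum_div, ← gibbsTensor_shift]
    rfl
  rw [h, Real.log_div (gibbsMass_pos C η hn γ).ne' hM.ne', dual, dual]
  simp_rw [sub_mul, Finset.sum_sub_distrib]
  ring

theorem sum_gibbsTensor_div (hn : 0 < n) (β : Vecs m n ℝ) :
    ∑ i, gibbsTensor C η β i / gibbsMass C η β = 1 := by
  rw [← Finset.sum_div]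
  exact div_self (gibbsMass_pos C η hn β).ne'

theorem sum_dualGrad_mul (β Δ : Vecs m n ℝ) :
    ∑ k, ∑ j, dualGrad C η r β k j * Δ k j =
      ∑ i, gibbsTensor C η β i / gibbsMass C η β * ∑ k, Δ k (i k) -
        ∑ k, ∑ j, Δ k j * r k j := by
  rw [sum_gibbsTensor_mul]
  simp_rw [dualGrad, sub_mul, Finset.sum_sub_distrib]
  congr 1
  simp_rw [mul_comm]

theorem dual_convex (hn : 0 < n) (β γ : Vecs m n ℝ) :
    dual C η r β + ∑ k, ∑ j, dualGrad C η r β k j * (γ k j - β k j) ≤ dual C η r γ := by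
  have h := dual_sub C η r hn β γ
  rw [sum_dualGrad_mul C η r β fun k j => γ k j - β k j]
  set p := fun i => gibbsTensor C η β i / gibbsMass C η β
  set d := fun i : Fin m → Fin n => ∑ k, (γ k (i k) - β k (i k))
  have hM := gibbsMass_pos C η hn β
  have hp : ∀ i, 0 < p i := fun i => div_pos (gibbsTensor_pos _ _ _ _) hM
  have hsum : ∑ i, p i = 1 := sum_gibbsTensor_div C η hn β
  have key : ∑ i, p i * d i ≤ Real.log (∑ i, p i * Real.exp (d i)) := by
    set μ := ∑ i, p i * d i
    have hexp : Real.exp μ ≤ ∑ i, p i * Real.exp (d i) := by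
      -- Jensen by the tangent line of exp at the mean μ, whose linear part averages to zero.
      have h1 : ∀ i, p i * (Real.exp μ * (d i - μ + 1)) ≤ p i * Real.exp (d i) := by
        intro i
        refine mul_le_mul_of_nonneg_left ?_ (hp i).le
        calc Real.exp μ * (d i - μ + 1) ≤ Real.exp μ * Real.exp (d i - μ) :=
              mul_le_mul_of_nonneg_left (Real.add_one_le_exp _) (Real.exp_pos _).le
          _ = Real.exp (d i) := by rw [← Real.exp_add]; congr 1; ring
      have h2 : ∑ i, p i * (Real.exp μ * (d i - μ + 1)) = Real.exp μ := by
        have : ∀ i, p i * (Real.exp μ * (d i - μ + 1)) =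
            Real.exp μ * (p i * d i) + Real.exp μ * (1 - μ) * p i := fun i => by ring
        simp_rw [this, Finset.sum_add_distrib, ← Finset.mul_sum]
        rw [hsum]
        ring
      rw [← h2]
      exact Finset.sum_le_sum fun i _ => h1 i
    calc μ = Real.log (Real.exp μ) := (Real.log_exp μ).symm
      _ ≤ _ := Real.log_le_log (Real.exp_pos _) hexp
  linarith

/-- Hoeffding's lemma applies to the exponent, which takes a single entry from each of the m blocks.
Cauchy–Schwarz bounds its square by m‖γ - β‖², so no factor n enters. -/
theorem dual_smooth (hn : 0 < n) (β γ : Vecs m n ℝ) :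
    dual C η r γ ≤ dual C η r β + ∑ k, ∑ j, dualGrad C η r β k j * (γ k j - β k j) +
      m / 2 * ∑ k, ∑ j, (γ k j - β k j) ^ 2 := by
  have h := dual_sub C η r hn β γ
  rw [sum_dualGrad_mul C η r β fun k j => γ k j - β k j]
  have hM := gibbsMass_pos C η hn β
  have hp : ∀ i, 0 < gibbsTensor C η β i / gibbsMass C η β :=
    fun i => div_pos (gibbsTensor_pos _ _ _ _) hM
  have hsum := sum_gibbsTensor_div C η hn β
  have hS : 0 ≤ (m : ℝ) * ∑ k, ∑ j, (γ k j - β k j) ^ 2 := by positivity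
  have hd : ∀ i : Fin m → Fin n, |∑ k, (γ k (i k) - β k (i k))| ≤
      Real.sqrt (m * ∑ k, ∑ j, (γ k j - β k j) ^ 2) := by
    intro i
    refine Real.abs_le_sqrt ?_
    refine (sq_sum_le_card_mul_sum_sq (s := Finset.univ)
      (f := fun k => γ k (i k) - β k (i k))).trans ?_
    rw [Finset.card_univ, Fintype.card_fin]
    refine mul_le_mul_of_nonneg_left (Finset.sum_le_sum fun k _ => ?_) (Nat.cast_nonneg m)
    exact Finset.single_le_sum (f := fun j => (γ k j - β k j) ^ 2) (fun j _ => sq_nonneg _)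
      (Finset.mem_univ (i k))
  have h1 := sum_mul_exp_le _ _ _ (fun i => (hp i).le) hsum hd
  rw [Real.sq_sqrt hS] at h1
  have hpos : 0 < ∑ i, gibbsTensor C η β i / gibbsMass C η β *
      Real.exp (∑ k, (γ k (i k) - β k (i k))) :=
    Finset.sum_pos (fun i _ => mul_pos (hp i) (Real.exp_pos _))
      ⟨fun _ => ⟨0, hn⟩, Finset.mem_univ _⟩
  have h2 := Real.log_le_log hpos h1
  rw [Real.log_exp] at h2
  linarith

variable {r}

/-! ### Decrease of the dual objective under a block update -/

theorem gibbsTensor_updateBlock (hr : ∀ k j, 0 < r k j) (K : Fin m) (β : Vecs m n ℝ)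
    (i : Fin m → Fin n) :
    gibbsTensor C η (updateBlock C η r K β) i =
      gibbsTensor C η β i * (r K (i K) / marg (gibbsTensor C η β) K (i K)) := by
  have hq := marg_pos (gibbsTensor_pos C η β) K (i K)
  rw [gibbsTensor_shift C η β]
  congr 1
  rw [Finset.sum_eq_single K]
  · rw [updateBlock, Function.update_self, ← Real.exp_log (div_pos (hr K (i K)) hq),
      Real.log_div (hr K (i K)).ne' hq.ne']
    congr 1
    ring
  · intro k _ hk
    rw [updateBlock, Function.update_of_ne hk, sub_self]
  · simp

theorem gibbsMass_updateBlock (hr : ∀ k j, 0 < r k j) (hsum : ∀ k, ∑ j, r k j = 1) (K : Fin m)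
    (β : Vecs m n ℝ) : gibbsMass C η (updateBlock C η r K β) = 1 := by
  rw [gibbsMass]
  simp_rw [gibbsTensor_updateBlock C η hr]
  rw [← sum_marg_mul _ K fun j => r K j / marg (gibbsTensor C η β) K j, ← hsum K]
  refine Finset.sum_congr rfl fun j _ => ?_
  exact mul_div_cancel₀ _ (marg_pos (gibbsTensor_pos C η β) K j).ne'

/-- The new mass is 1, so its logarithm vanishes, and what remains of the decrease is the
Kullback–Leibler divergence of r_K from the normalised K-th marginal. -/
theorem dual_updateBlock (hr : ∀ k j, 0 < r k j) (hsum : ∀ k, ∑ j, r k j = 1)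
    (hn : 0 < n) (K : Fin m) (β : Vecs m n ℝ) :
    dual C η r (updateBlock C η r K β) = dual C η r β -
      ∑ j, r K j * Real.log (r K j / (marg (gibbsTensor C η β) K j / gibbsMass C η β)) := by
  have hM := gibbsMass_pos C η hn β
  have h1 : ∑ k, ∑ j, updateBlock C η r K β k j * r k j = ∑ k, ∑ j, β k j * r k j +
      ∑ j, (Real.log (r K j) - Real.log (marg (gibbsTensor C η β) K j)) * r K j := by
    rw [← sub_eq_iff_eq_add', ← Finset.sum_sub_distrib, Finset.sum_eq_single K]
    · rw [updateBlock, Function.update_self, ← Finset.sum_sub_distrib]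
      refine Finset.sum_congr rfl fun j _ => ?_
      ring
    · intro k _ hk
      rw [updateBlock, Function.update_of_ne hk, sub_self]
    · simp
  have h2 : ∑ j, r K j * Real.log (r K j / (marg (gibbsTensor C η β) K j / gibbsMass C η β)) =
      ∑ j, (Real.log (r K j) - Real.log (marg (gibbsTensor C η β) K j)) * r K j +
        Real.log (gibbsMass C η β) := by
    rw [← mul_one (Real.log (gibbsMass C η β)), ← hsum K, Finset.mul_sum,
      ← Finset.sum_add_distrib]
    refine Finset.sum_congr rfl fun j _ => ?_
    have hq := marg_pos (gibbsTensor_pos C η β) K j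
    rw [Real.log_div (hr K j).ne' (div_pos hq hM).ne', Real.log_div hq.ne' hM.ne']
    ring
  rw [dual, gibbsMass_updateBlock C η hr hsum, Real.log_one, h1, h2, dual]
  ring

theorem sq_sum_abs_le_dual_sub (hr : ∀ k j, 0 < r k j) (hsum : ∀ k, ∑ j, r k j = 1)
    (hn : 0 < n) (K : Fin m) (β : Vecs m n ℝ) :
    (∑ j, |marg (gibbsTensor C η β) K j / gibbsMass C η β - r K j|) ^ 2 ≤
      4 * (dual C η r β - dual C η r (updateBlock C η r K β)) := by
  have hM := gibbsMass_pos C η hn β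
  rw [dual_updateBlock C η hr hsum hn, sub_sub_cancel]
  refine sq_sum_abs_le_entropy _ _ (fun j => (hr K j).le)
    (fun j => div_pos (marg_pos (gibbsTensor_pos C η β) K j) hM) (hsum K) ?_
  rw [← Finset.sum_div, sum_marg]
  exact div_self hM.ne'

theorem dual_updateBlock_le (hr : ∀ k j, 0 < r k j) (hsum : ∀ k, ∑ j, r k j = 1)
    (hn : 0 < n) (K : Fin m) (β : Vecs m n ℝ) :
    dual C η r (updateBlock C η r K β) ≤ dual C η r β := by
  have := sq_sum_abs_le_dual_sub C η hr hsum hn K β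
  nlinarith [sq_nonneg (∑ j, |marg (gibbsTensor C η β) K j / gibbsMass C η β - r K j|)]

/-- A greedy block update decreases the dual objective by a multiple of the squared residue. -/
theorem sq_margError_le (hr : ∀ k j, 0 < r k j) (hsum : ∀ k, ∑ j, r k j = 1)
    (hn : 0 < n) (tie : Fin m → Bool) (k₀ : Fin m) (β : Vecs m n ℝ)
    (hmass : gibbsMass C η β = 1) :
    margError r (gibbsTensor C η β) ^ 2 ≤ 4 * m ^ 2 *
      (dual C η r β - dual C η r (updateBlock C η r (greedyCoord tie C η r k₀ β) β)) := by
  -- At mass 1 the linear part of ρ vanishes, so maximising ρ over the blocks is maximising the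
  -- decrease of φ.
  have hent : ∀ k, relEntropy (r k) (marg (gibbsTensor C η β) k) =
      dual C η r β - dual C η r (updateBlock C η r k β) := by
    intro k
    rw [dual_updateBlock C η hr hsum hn, sub_sub_cancel, relEntropy, Finset.sum_sub_distrib,
      sum_marg, hsum, hmass]
    have : ∑ i, gibbsTensor C η β i = 1 := hmass
    simp [this]
  set K := greedyCoord tie C η r k₀ β with hK
  set G := dual C η r β - dual C η r (updateBlock C η r K β) with hG
  have hk : ∀ k, (∑ j, |marg (gibbsTensor C η β) k j - r k j|) ^ 2 ≤ 4 * G := by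
    intro k
    have h1 := sq_sum_abs_le_dual_sub C η hr hsum hn k β
    have h2 := le_greedyCoord tie C η r k₀ β k
    rw [← hK, hent, hent, ← hG] at h2
    simp only [hmass, div_one] at h1
    linarith
  -- One factor m comes from Cauchy–Schwarz over the blocks, the other from bounding each of the m
  -- blocks by the greedy decrease.
  calc margError r (gibbsTensor C η β) ^ 2
      ≤ m * ∑ k, (∑ j, |marg (gibbsTensor C η β) k j - r k j|) ^ 2 := by
        have := sq_sum_le_card_mul_sum_sq (s := Finset.univ)
          (f := fun k => ∑ j, |marg (gibbsTensor C η β) k j - r k j|)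
        simpa [margError] using this
    _ ≤ m * ∑ _k : Fin m, 4 * G :=
        mul_le_mul_of_nonneg_left (Finset.sum_le_sum fun k _ => hk k) (Nat.cast_nonneg m)
    _ = 4 * m ^ 2 * G := by simp; ring

end Dual

/-! ### Minimisers of the dual objective -/

section Minimiser

variable {m n : ℕ} (C : Tensor m n ℝ) {η : ℝ} {r : Vecs m n ℝ}

/-- The representative of `β` up to block shifts with `∑ j, exp (β k j) = 1`. -/
noncomputable def normalize (β : Vecs m n ℝ) : Vecs m n ℝ :=
  fun k j => β k j - Real.log (∑ l, Real.exp (β k l))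

theorem sum_exp_normalize (hn : 0 < n) (β : Vecs m n ℝ) (k : Fin m) :
    ∑ j, Real.exp (normalize β k j) = 1 := by
  have hpos : 0 < ∑ l, Real.exp (β k l) :=
    Finset.sum_pos (fun _ _ => Real.exp_pos _) ⟨⟨0, hn⟩, Finset.mem_univ _⟩
  simp_rw [normalize, Real.exp_sub, Real.exp_log hpos, ← Finset.sum_div]
  exact div_self hpos.ne'

theorem nonpos_of_sum_exp {x : Fin n → ℝ} (h : ∑ j, Real.exp (x j) = 1) (j : Fin n) :
    x j ≤ 0 := by
  rw [← Real.exp_le_one_iff, ← h]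
  exact Finset.single_le_sum (f := fun j => Real.exp (x j)) (fun _ _ => (Real.exp_pos _).le)
    (Finset.mem_univ j)

/-- Shifting a block by a constant c multiplies B by exp c and adds c to ⟨β_k, r_k⟩, because r_k has
mass 1; the two changes cancel. -/
theorem dual_normalize (hn : 0 < n) (hsum : ∀ k, ∑ j, r k j = 1) (β : Vecs m n ℝ) :
    dual C η r (normalize β) = dual C η r β := by
  have h := dual_sub C η r hn β (normalize β)
  have hd : ∀ k j, normalize β k j - β k j = -Real.log (∑ l, Real.exp (β k l)) := by
    intro k j
    rw [normalize]
    ring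
  simp_rw [hd, ← Finset.sum_mul, sum_gibbsTensor_div C η hn, one_mul, ← Finset.mul_sum,
    hsum, Real.log_exp, mul_one, sub_self] at h
  exact sub_eq_zero.1 h

theorem gibbsTensor_le (hC : ∀ i, 0 ≤ C i) (hη : 0 < η) (β : Vecs m n ℝ) (i : Fin m → Fin n) :
    gibbsTensor C η β i ≤ ∏ k, Real.exp (β k (i k)) := by
  rw [gibbsTensor, ← Real.exp_sum]
  exact Real.exp_le_exp.2 (sub_le_self _ (div_nonneg (hC i) hη.le))

theorem le_gibbsTensor (hη : 0 < η) (β : Vecs m n ℝ) (i : Fin m → Fin n) :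
    Real.exp (-(‖C‖ / η)) * ∏ k, Real.exp (β k (i k)) ≤ gibbsTensor C η β i := by
  rw [gibbsTensor, ← Real.exp_sum, ← Real.exp_add]
  refine Real.exp_le_exp.2 ?_
  have : C i / η ≤ ‖C‖ / η :=
    div_le_div_of_nonneg_right ((le_abs_self _).trans (norm_le_pi_norm C i)) hη.le
  linarith

theorem exp_le_gibbsMass (hη : 0 < η) {β : Vecs m n ℝ}
    (hβ : ∀ k, ∑ j, Real.exp (β k j) = 1) : Real.exp (-(‖C‖ / η)) ≤ gibbsMass C η β := by
  have h := Finset.sum_le_sum fun i (_ : i ∈ Finset.univ) => le_gibbsTensor C hη β i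
  rw [← Finset.mul_sum, sum_prod_tensor fun k j => Real.exp (β k j)] at h
  simpa [hβ, gibbsMass] using h

/-- Normalised potentials are nonpositive, so every term -β r is nonnegative and all but one may be
dropped. Hence φ grows linearly as any coordinate tends to -∞. -/
theorem le_dual_of_sum_exp (hη : 0 < η) {ρ : ℝ} (hρ : 0 < ρ) (hr : ∀ k j, ρ ≤ r k j)
    {β : Vecs m n ℝ} (hβ : ∀ k, ∑ j, Real.exp (β k j) = 1) (k : Fin m) (j : Fin n) :
    -(‖C‖ / η) - β k j * ρ ≤ dual C η r β := by
  have h1 := Real.log_le_log (Real.exp_pos _) (exp_le_gibbsMass C hη hβ)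
  rw [Real.log_exp] at h1
  have hle : ∀ k j, β k j * r k j ≤ 0 := fun k j =>
    mul_nonpos_of_nonpos_of_nonneg (nonpos_of_sum_exp (hβ k) j) (hρ.le.trans (hr k j))
  have h2 : ∑ k, ∑ j, β k j * r k j ≤ β k j * r k j := by
    have ha : ∑ k, ∑ j, β k j * r k j ≤ ∑ j, β k j * r k j := by
      have := Finset.single_le_sum (f := fun k => -∑ j, β k j * r k j)
        (fun k _ => neg_nonneg.2 (Finset.sum_nonpos fun j _ => hle k j)) (Finset.mem_univ k)
      simpa using this
    have hb : ∑ j, β k j * r k j ≤ β k j * r k j := by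
      have := Finset.single_le_sum (f := fun j => -(β k j * r k j))
        (fun j _ => neg_nonneg.2 (hle k j)) (Finset.mem_univ j)
      simpa using this
    exact ha.trans hb
  have h3 : β k j * r k j ≤ β k j * ρ :=
    mul_le_mul_of_nonpos_left (hr k j) (nonpos_of_sum_exp (hβ k) j)
  rw [dual]
  linarith

theorem continuous_dual (hn : 0 < n) : Continuous (dual C η r) := by
  have hB : ∀ i, Continuous fun β : Vecs m n ℝ => gibbsTensor C η β i := by
    intro i
    unfold gibbsTensor
    fun_prop
  have hM : Continuous (gibbsMass C η) := by
    unfold gibbsMass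
    exact continuous_finsetSum _ fun i _ => hB i
  unfold dual
  refine (hM.log fun β => (gibbsMass_pos C η hn β).ne').sub ?_
  fun_prop

/-- Shift invariance prevents coercivity of φ, but on normalised potentials φ exceeds a reference
value outside a compact box, and every potential can be normalised. -/
theorem exists_forall_dual_le (hn : 0 < n) (hη : 0 < η) {ρ : ℝ} (hρ : 0 < ρ)
    (hr : ∀ k j, ρ ≤ r k j) (hsum : ∀ k, ∑ j, r k j = 1) :
    ∃ γ, ∀ β, dual C η r γ ≤ dual C η r β := by
  obtain ⟨M, hM⟩ : ∃ M : ℝ, ∀ k j, normalize (0 : Vecs m n ℝ) k j ≥ -M ∧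
      dual C η r (normalize 0) ≤ -(‖C‖ / η) + M * ρ := by
    -- The first bound puts `normalize 0`, whose entries are -log n, into the box; the second makes
    -- φ larger outside the box than at `normalize 0`.
    refine ⟨max (Real.log n) ((dual C η r (normalize 0) + ‖C‖ / η) / ρ), fun k j => ⟨?_, ?_⟩⟩
    · simp [normalize]
    · have := (div_le_iff₀ hρ).1
        (le_max_right (Real.log n) ((dual C η r (normalize 0) + ‖C‖ / η) / ρ))
      linarith
  have hmem : normalize (0 : Vecs m n ℝ) ∈ Set.Icc (fun _ _ => -M : Vecs m n ℝ) 0 :=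
    ⟨fun k j => (hM k j).1, fun k j => nonpos_of_sum_exp (sum_exp_normalize hn 0 k) j⟩
  obtain ⟨γ, -, hγ⟩ := (isCompact_Icc (a := (fun _ _ => -M : Vecs m n ℝ)) (b := 0)).exists_isMinOn
    ⟨_, hmem⟩ (continuous_dual C (η := η) (r := r) hn).continuousOn
  refine ⟨γ, fun β => ?_⟩
  have hβ := sum_exp_normalize hn β
  rw [← dual_normalize C hn hsum β]
  by_cases hbox : ∀ k j, -M ≤ normalize β k j
  · exact hγ ⟨fun k j => hbox k j, fun k j => nonpos_of_sum_exp (hβ k) j⟩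
  · push Not at hbox
    obtain ⟨k, j, hkj⟩ := hbox
    have h1 := le_dual_of_sum_exp C hη hρ hr hβ k j
    have h2 : dual C η r γ ≤ dual C η r (normalize 0) := hγ hmem
    nlinarith [(hM k j).2]

/-- The dual objective has a minimiser of controlled size. -/
theorem exists_minimiser (hn : 0 < n) (hC : ∀ i, 0 ≤ C i) (hη : 0 < η) {ρ : ℝ} (hρ : 0 < ρ)
    (hr : ∀ k j, ρ ≤ r k j) (hsum : ∀ k, ∑ j, r k j = 1) :
    ∃ γ, (∀ β, dual C η r γ ≤ dual C η r β) ∧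
      ∀ k j, |γ k j| ≤ ‖C‖ / η - Real.log ρ := by
  obtain ⟨γ₀, hγ₀⟩ := exists_forall_dual_le C hn hη hρ hr hsum
  have hmin : ∀ β, dual C η r (normalize γ₀) ≤ dual C η r β := fun β =>
    (dual_normalize C hn hsum γ₀).trans_le (hγ₀ β)
  have hγ := sum_exp_normalize hn γ₀
  generalize normalize γ₀ = γ at hmin hγ
  refine ⟨γ, hmin, fun k j => ?_⟩
  have hrpos : ∀ k j, 0 < r k j := fun k j => hρ.trans_le (hr k j)
  have hM := gibbsMass_pos C η hn γ
  have h0 := sq_sum_abs_le_dual_sub C η hrpos hsum hn k γ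
  -- No block update can improve a minimiser, so Pinsker forces its normalised marginals to be r.
  have h1 : ∑ j, |marg (gibbsTensor C η γ) k j / gibbsMass C η γ - r k j| = 0 := by
    have := hmin (updateBlock C η r k γ)
    refine pow_eq_zero_iff two_ne_zero |>.1 (le_antisymm ?_ (sq_nonneg _))
    linarith
  have h2 : marg (gibbsTensor C η γ) k j = r k j * gibbsMass C η γ := by
    have := (Finset.sum_eq_zero_iff_of_nonneg fun j _ => _root_.abs_nonneg _).1 h1 j
      (Finset.mem_univ j)
    rw [← div_eq_iff hM.ne']
    exact sub_eq_zero.1 (abs_eq_zero.1 this)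
  -- As C ≥ 0, B(γ) lies below a product tensor whose k-th marginal is exp(γ_k). A small γ_kj would
  -- thus make the marginal smaller than ρ times the mass.
  have h3 : marg (gibbsTensor C η γ) k j ≤ Real.exp (γ k j) := by
    refine (marg_mono (gibbsTensor_le C hC hη γ) k j).trans ?_
    rw [marg_prod fun k j => Real.exp (γ k j)]
    simp [hγ]
  have h4 := exp_le_gibbsMass C hη hγ
  have h5 : ρ * Real.exp (-(‖C‖ / η)) ≤ Real.exp (γ k j) :=
    (mul_le_mul (hr k j) h4 (Real.exp_pos _).le (hrpos k j).le).trans (h2 ▸ h3)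
  have h6 := Real.log_le_log (mul_pos hρ (Real.exp_pos _)) h5
  rw [Real.log_mul hρ.ne' (Real.exp_pos _).ne', Real.log_exp, Real.log_exp] at h6
  rw [abs_of_nonpos (nonpos_of_sum_exp (hγ k) j)]
  linarith

end Minimiser

/-! ### Convergence of the accelerated algorithm -/

section Acceleration

variable {m n : ℕ} (tie : TieRule m) (C : Tensor m n ℝ) (η : ℝ) (r : Vecs m n ℝ) (k₀ : Fin m)

theorem accState_theta_succ (t : ℕ) :
    (accState tie C η r k₀ (t + 1)).θ = (accState tie C η r k₀ t).θ *
      (Real.sqrt ((accState tie C η r k₀ t).θ * (accState tie C η r k₀ t).θ + 4) -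
        (accState tie C η r k₀ t).θ) / 2 := rfl

theorem accState_theta_pos (t : ℕ) : 0 < (accState tie C η r k₀ t).θ := by
  induction t with
  | zero => exact one_pos
  | succ t ih =>
    rw [accState_theta_succ]
    refine half_pos (mul_pos ih (sub_pos.2 (Real.lt_sqrt_of_sq_lt ?_)))
    linarith

/-- The update of θ is the positive root x of x² + θ²x = θ². This relation turns the weight of one
step into that of the next in the potential argument. -/
theorem sq_accState_theta_succ (t : ℕ) :
    (accState tie C η r k₀ (t + 1)).θ ^ 2 =
      (1 - (accState tie C η r k₀ (t + 1)).θ) * (accState tie C η r k₀ t).θ ^ 2 := by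
  rw [accState_theta_succ]
  generalize (accState tie C η r k₀ t).θ = θ
  have := Real.sq_sqrt (show 0 ≤ θ * θ + 4 by nlinarith [mul_self_nonneg θ])
  linear_combination (θ ^ 2 / 4) * this

theorem accState_theta_le (t : ℕ) : (accState tie C η r k₀ t).θ ≤ 2 / (t + 2) := by
  induction t with
  | zero => norm_num [accState]
  | succ t ih =>
    have hq := sq_accState_theta_succ tie C η r k₀ t
    have hθ2 := pow_le_pow_left₀ (accState_theta_pos tie C η r k₀ t).le ih 2
    have hxp := accState_theta_pos tie C η r k₀ (t + 1)
    generalize (accState tie C η r k₀ (t + 1)).θ = x at hq hxp ⊢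
    generalize (accState tie C η r k₀ t).θ = θ at hq hθ2 ih
    have hs : (0 : ℝ) < (t : ℝ) + 2 := by positivity
    rw [le_div_iff₀ (by positivity)]
    push_cast
    -- The recursion reads x² ≤ (1 - x)(2/(t+2))², which already fails at x = 2/(t+3) and therefore
    -- for all larger x.
    by_contra hcon
    push Not at hcon
    by_cases hx1 : 1 - x ≤ 0
    · nlinarith [mul_nonneg (neg_nonneg.2 hx1) (sq_nonneg θ), pow_pos hxp 2]
    · push Not at hx1
      have h1 : x ^ 2 ≤ (1 - x) * (2 / ((t : ℝ) + 2)) ^ 2 := by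
        rw [hq]
        exact mul_le_mul_of_nonneg_left hθ2 hx1.le
      rw [div_pow, mul_div_assoc', le_div_iff₀ (by positivity)] at h1
      nlinarith [mul_pos hxp hs]

theorem accState_theta_le_one (t : ℕ) : (accState tie C η r k₀ t).θ ≤ 1 := by
  refine (accState_theta_le tie C η r k₀ t).trans ?_
  rw [div_le_one (by positivity)]
  linarith [(Nat.cast_nonneg t : (0 : ℝ) ≤ t)]

variable {r}

theorem dual_best_le (keep : Bool) (s : AccState m n ℝ) :
    dual C η r (s.best keep C η r) ≤ dual C η r s.check ∧
      dual C η r (s.best keep C η r) ≤ dual C η r (s.hat C η r) := by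
  rw [AccState.best]
  split_ifs with h1 h2
  · exact ⟨le_rfl, h1.le⟩
  · exact ⟨le_rfl, h2.le⟩
  · exact ⟨h2.ge, le_rfl⟩
  · exact ⟨not_lt.1 h1, le_rfl⟩

theorem best_eq_or (keep : Bool) (s : AccState m n ℝ) :
    s.best keep C η r = s.check ∨ s.best keep C η r = s.hat C η r := by
  rw [AccState.best]
  split_ifs <;> simp

/-- From index 1 on both candidates of step 5 are block updates. Index 0 is excluded because `check`
is then 0, whose mass need not be 1. -/
theorem gibbsMass_accIter (hr : ∀ k j, 0 < r k j) (hsum : ∀ k, ∑ j, r k j = 1) (t : ℕ) :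
    gibbsMass C η (accIter tie C η r k₀ (t + 1)) = 1 := by
  rcases best_eq_or C η (r := r) (tie.keep (t + 1)) (accState tie C η r k₀ (t + 1)) with h | h
  · rw [accIter, h]
    exact gibbsMass_updateBlock C η hr hsum _ _
  · rw [accIter, h]
    exact gibbsMass_updateBlock C η hr hsum _ _

theorem dual_check_succ_le (hr : ∀ k j, 0 < r k j) (hsum : ∀ k, ∑ j, r k j = 1)
    (hn : 0 < n) (t : ℕ) :
    dual C η r (accState tie C η r k₀ (t + 1)).check ≤ dual C η r (accIter tie C η r k₀ t) :=
  dual_updateBlock_le C η hr hsum hn _ _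

/-- The usual one-step estimate: smoothness from `bar` to `grave`, and convexity at `bar` towards γ
and `check` with weights θ and 1 - θ. Steps 4, 5 and 7 only lower the left side further. -/
theorem accStep (hr : ∀ k j, 0 < r k j) (hsum : ∀ k, ∑ j, r k j = 1)
    (hn : 0 < n) (hm : 0 < m) (γ : Vecs m n ℝ) (t : ℕ) :
    dual C η r (accState tie C η r k₀ (t + 1)).check - dual C η r γ ≤
      (1 - (accState tie C η r k₀ t).θ) *
        (dual C η r (accState tie C η r k₀ t).check - dual C η r γ) +
      m * (accState tie C η r k₀ t).θ ^ 2 / 2 *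
        (∑ k, ∑ j, (γ k j - (accState tie C η r k₀ t).tilde k j) ^ 2 -
          ∑ k, ∑ j, (γ k j - (accState tie C η r k₀ (t + 1)).tilde k j) ^ 2) := by
  have hθ := accState_theta_pos tie C η r k₀ t
  have hθ1 := accState_theta_le_one tie C η r k₀ t
  have h1 := dual_check_succ_le tie C η k₀ hr hsum hn t
  have htil : (accState tie C η r k₀ (t + 1)).tilde =
    (accState tie C η r k₀ t).nextTilde C η r := rfl
  have h2 : dual C η r (accIter tie C η r k₀ t) ≤
      dual C η r ((accState tie C η r k₀ t).hat C η r) := (dual_best_le C η _ _).2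
  rw [htil]
  generalize accState tie C η r k₀ t = s at hθ hθ1 h2 ⊢
  have h3 : dual C η r (s.hat C η r) ≤ dual C η r (s.grave C η r) :=
    dual_updateBlock_le C η hr hsum hn _ _
  have h4 := dual_smooth C η r hn s.bar (s.grave C η r)
  have h5 := dual_convex C η r hn s.bar γ
  have h6 := dual_convex C η r hn s.bar s.check
  have hmθ : (m : ℝ) * s.θ ≠ 0 := by positivity
  -- An exact identity in each coordinate: θγ + (1 - θ)`check` - `bar` = θ(γ - `tilde`), and with
  -- step size 1/(mθ) completing the square leaves -g²/(2m) on both sides.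
  have key : ∑ k, ∑ j, dualGrad C η r s.bar k j * (s.grave C η r k j - s.bar k j) +
      m / 2 * ∑ k, ∑ j, (s.grave C η r k j - s.bar k j) ^ 2 =
      s.θ * ∑ k, ∑ j, dualGrad C η r s.bar k j * (γ k j - s.bar k j) +
      (1 - s.θ) * ∑ k, ∑ j, dualGrad C η r s.bar k j * (s.check k j - s.bar k j) +
      m * s.θ ^ 2 / 2 * (∑ k, ∑ j, (γ k j - s.tilde k j) ^ 2 -
        ∑ k, ∑ j, (γ k j - s.nextTilde C η r k j) ^ 2) := by
    simp only [Finset.mul_sum, ← Finset.sum_add_distrib, ← Finset.sum_sub_distrib]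
    refine Finset.sum_congr rfl fun k _ => Finset.sum_congr rfl fun j _ => ?_
    rw [AccState.grave, AccState.nextTilde, AccState.bar]
    generalize dualGrad C η r s.bar k j = g
    field_simp
    ring
  nlinarith [mul_le_mul_of_nonneg_left h5 hθ.le, mul_le_mul_of_nonneg_left h6 (sub_nonneg.2 hθ1)]

theorem dual_check_sub_le (hr : ∀ k j, 0 < r k j) (hsum : ∀ k, ∑ j, r k j = 1)
    (hn : 0 < n) (hm : 0 < m) (γ : Vecs m n ℝ) (t : ℕ) :
    dual C η r (accState tie C η r k₀ (t + 1)).check - dual C η r γ ≤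
      2 * m / (t + 2) ^ 2 * ∑ k, ∑ j, γ k j ^ 2 := by
  -- The potential is the gap plus a weighted squared distance to γ. It starts correctly since θ_0 =
  -- 1 removes the initial gap and `tilde` starts at 0.
  have inv : ∀ t, dual C η r (accState tie C η r k₀ (t + 1)).check - dual C η r γ +
      m * (accState tie C η r k₀ t).θ ^ 2 / 2 *
        ∑ k, ∑ j, (γ k j - (accState tie C η r k₀ (t + 1)).tilde k j) ^ 2 ≤
      m * (accState tie C η r k₀ t).θ ^ 2 / 2 * ∑ k, ∑ j, γ k j ^ 2 := by
    intro t
    induction t with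
    | zero =>
      have h := accStep tie C η k₀ hr hsum hn hm γ 0
      have h1 : (accState tie C η r k₀ 0).θ = 1 := rfl
      have h2 : (accState tie C η r k₀ 0).tilde = fun _ _ => 0 := rfl
      simp only [h1, h2, sub_zero, sub_self, zero_mul, zero_add] at h ⊢
      linarith
    | succ t ih =>
      have h := accStep tie C η k₀ hr hsum hn hm γ (t + 1)
      have hq := sq_accState_theta_succ tie C η r k₀ t
      have hθ1 := sub_nonneg.2 (accState_theta_le_one tie C η r k₀ (t + 1))
      have ih' := mul_le_mul_of_nonneg_left ih hθ1
      have hq' : ∀ S : ℝ, m * (accState tie C η r k₀ (t + 1)).θ ^ 2 / 2 * S =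
          (1 - (accState tie C η r k₀ (t + 1)).θ) *
            (m * (accState tie C η r k₀ t).θ ^ 2 / 2 * S) := by
        intro S
        rw [hq]
        ring
      rw [mul_sub] at h
      rw [mul_add] at ih'
      simp only [← hq'] at ih'
      linarith
  have hD : 0 ≤ ∑ k, ∑ j, (γ k j - (accState tie C η r k₀ (t + 1)).tilde k j) ^ 2 := by positivity
  have hS : 0 ≤ ∑ k, ∑ j, γ k j ^ 2 := by positivity
  have hmt : (0 : ℝ) ≤ m * (accState tie C η r k₀ t).θ ^ 2 / 2 := by positivity
  calc dual C η r (accState tie C η r k₀ (t + 1)).check - dual C η r γ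
      ≤ m * (accState tie C η r k₀ t).θ ^ 2 / 2 * ∑ k, ∑ j, γ k j ^ 2 := by
        nlinarith [inv t, mul_nonneg hmt hD]
    _ ≤ m * (2 / ((t : ℝ) + 2)) ^ 2 / 2 * ∑ k, ∑ j, γ k j ^ 2 := by
        refine mul_le_mul_of_nonneg_right ?_ hS
        have := pow_le_pow_left₀ (accState_theta_pos tie C η r k₀ t).le
          (accState_theta_le tie C η r k₀ t) 2
        nlinarith [(Nat.cast_nonneg m : (0 : ℝ) ≤ m)]
    _ = _ := by
        rw [div_pow]
        ring

/-- The residue cannot stay large for many iterations. -/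
theorem accResidue_large_bound (hr : ∀ k j, 0 < r k j) (hsum : ∀ k, ∑ j, r k j = 1) (hn : 0 < n)
    (hm : 0 < m) (γ : Vecs m n ℝ) (hγ : ∀ β, dual C η r γ ≤ dual C η r β) {tol : ℝ}
    (htol : 0 ≤ tol) (s d : ℕ)
    (hgo : ∀ i < s + 1 + d, tol < accResidue tie C η r k₀ i) :
    d * tol ^ 2 * (s + 2) ^ 2 ≤ 8 * m ^ 3 * ∑ k, ∑ j, γ k j ^ 2 := by
  -- The decreases are summed from iteration s + 1 on, where the mass is 1 and the greedy estimate
  -- applies.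
  have tele : ∀ d : ℕ, (∀ i < s + 1 + d, tol < accResidue tie C η r k₀ i) →
      d * tol ^ 2 ≤ 4 * m ^ 2 * (dual C η r (accState tie C η r k₀ (s + 1)).check -
        dual C η r (accState tie C η r k₀ (s + 1 + d)).check) := by
    intro d
    induction d with
    | zero => simp
    | succ d ih =>
      intro h
      have ih' := ih fun i hi => h i (by omega)
      have h1 : tol < accResidue tie C η r k₀ (s + 1 + d) := h _ (by omega)
      have h2 : tol ^ 2 ≤ accResidue tie C η r k₀ (s + 1 + d) ^ 2 :=
        pow_le_pow_left₀ htol h1.le 2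
      have hmass : gibbsMass C η (accIter tie C η r k₀ (s + 1 + d)) = 1 := by
        rw [show s + 1 + d = s + d + 1 by omega]
        exact gibbsMass_accIter tie C η k₀ hr hsum _
      have h3 := sq_margError_le C η hr hsum hn (tie.coord (s + 1 + d)) k₀ _ hmass
      have h4 : updateBlock C η r (greedyCoord (tie.coord (s + 1 + d)) C η r k₀
          (accIter tie C η r k₀ (s + 1 + d))) (accIter tie C η r k₀ (s + 1 + d)) =
          (accState tie C η r k₀ (s + 1 + (d + 1))).check := rfl
      rw [h4] at h3
      have h5 : dual C η r (accIter tie C η r k₀ (s + 1 + d)) ≤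
        dual C η r (accState tie C η r k₀ (s + 1 + d)).check := (dual_best_le C η _ _).1
      have h6 := mul_le_mul_of_nonneg_left h5 (show (0 : ℝ) ≤ 4 * m ^ 2 by positivity)
      rw [accResidue] at h2
      push_cast
      linarith
  have h1 := tele d hgo
  -- The accelerated rate bounds the gap at s + 1, from which the following d decreases are taken.
  have h2 := dual_check_sub_le tie C η k₀ hr hsum hn hm γ s
  have h3 := hγ (accState tie C η r k₀ (s + 1 + d)).check
  have h4 : (d : ℝ) * tol ^ 2 ≤ 4 * m ^ 2 * (2 * m / (s + 2) ^ 2 * ∑ k, ∑ j, γ k j ^ 2) :=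
    h1.trans (mul_le_mul_of_nonneg_left (by linarith) (by positivity))
  calc (d : ℝ) * tol ^ 2 * (s + 2) ^ 2
      ≤ 4 * m ^ 2 * (2 * m / (s + 2) ^ 2 * ∑ k, ∑ j, γ k j ^ 2) * (s + 2) ^ 2 :=
        mul_le_mul_of_nonneg_right h4 (by positivity)
    _ = _ := by field_simp; ring

end Acceleration

/-! ### Rounding to prescribed marginals -/

section Rounding

variable {m n : ℕ}

theorem scaleMarginal_nonneg {r : Vecs m n ℝ} (hr : ∀ k j, 0 ≤ r k j) {X : Tensor m n ℝ}
    (hX : ∀ i, 0 ≤ X i) (k : Fin m) (i : Fin m → Fin n) : 0 ≤ scaleMarginal r X k i :=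
  mul_nonneg (le_min zero_le_one (div_nonneg (hr _ _) (marg_nonneg hX _ _))) (hX i)

theorem scaleMarginal_le {r : Vecs m n ℝ} {X : Tensor m n ℝ}
    (hX : ∀ i, 0 ≤ X i) (k : Fin m) (i : Fin m → Fin n) : scaleMarginal r X k i ≤ X i :=
  mul_le_of_le_one_left (hX i) (min_le_left _ _)

theorem marg_scaleMarginal {r : Vecs m n ℝ} (hr : ∀ k j, 0 ≤ r k j) {X : Tensor m n ℝ}
    (hX : ∀ i, 0 ≤ X i) (k : Fin m) (j : Fin n) :
    marg (scaleMarginal r X k) k j = Min.min (marg X k j) (r k j) := by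
  have h : marg (scaleMarginal r X k) k j = Min.min 1 (r k j / marg X k j) * marg X k j := by
    simp only [marg, Finset.mul_sum]
    refine Finset.sum_congr rfl fun i hi => ?_
    rw [scaleMarginal, (Finset.mem_filter.1 hi).2]
    rfl
  rw [h]
  rcases (marg_nonneg hX k j).eq_or_lt with h0 | h0
  · rw [← h0, mul_zero, min_eq_left (hr k j)]
  · rw [min_mul_of_nonneg _ _ h0.le, one_mul, div_mul_cancel₀ _ h0.ne']

/-- Later scalings only shrink entries, so a marginal once below its target stays below. The mass
lost at each stage is the excess of the current marginal, at most that of the original tensor. -/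
theorem foldl_scaleMarginal {r : Vecs m n ℝ} (hr : ∀ k j, 0 ≤ r k j) (l : List (Fin m)) :
    ∀ X : Tensor m n ℝ, (∀ i, 0 ≤ X i) →
      (∀ i, 0 ≤ l.foldl (scaleMarginal r) X i ∧ l.foldl (scaleMarginal r) X i ≤ X i) ∧
      (∀ k ∈ l, ∀ j, marg (l.foldl (scaleMarginal r) X) k j ≤ r k j) ∧
      ∑ i, X i - ∑ i, l.foldl (scaleMarginal r) X i ≤
        (l.map fun k => ∑ j, Max.max (marg X k j - r k j) 0).sum := by
  induction l with
  | nil =>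
    intro X hX
    simpa using hX
  | cons x l ih =>
    intro X hX
    have hle := scaleMarginal_le (r := r) hX x
    obtain ⟨h1, h2, h3⟩ := ih (scaleMarginal r X x) (scaleMarginal_nonneg hr hX x)
    simp only [List.foldl_cons, List.map_cons, List.sum_cons, List.mem_cons, forall_eq_or_imp]
    refine ⟨fun i => ⟨(h1 i).1, (h1 i).2.trans (hle i)⟩, ⟨fun j => ?_, h2⟩, ?_⟩
    · refine (marg_mono (fun i => (h1 i).2) x j).trans ?_
      rw [marg_scaleMarginal hr hX]
      exact min_le_right _ _
    · have h4 : ∑ i, X i - ∑ i, scaleMarginal r X x i =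
          ∑ j, Max.max (marg X x j - r x j) 0 := by
        rw [← sum_marg X x, ← sum_marg (scaleMarginal r X x) x, ← Finset.sum_sub_distrib]
        refine Finset.sum_congr rfl fun j _ => ?_
        rw [marg_scaleMarginal hr hX]
        rcases le_total (marg X x j) (r x j) with h | h
        · rw [min_eq_left h, max_eq_right (sub_nonpos.2 h), sub_self]
        · rw [min_eq_right h, max_eq_left (sub_nonneg.2 h)]
      have h5 : (l.map fun k => ∑ j, Max.max (marg (scaleMarginal r X x) k j - r k j) 0).sum ≤
          (l.map fun k => ∑ j, Max.max (marg X k j - r k j) 0).sum := by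
        refine List.sum_le_sum fun k _ => Finset.sum_le_sum fun j _ => ?_
        exact max_le_max (sub_le_sub_right (marg_mono hle k j) _) le_rfl
      linarith

theorem scaleMarginals_spec {r : Vecs m n ℝ} (hr : ∀ k j, 0 ≤ r k j) {X : Tensor m n ℝ}
    (hX : ∀ i, 0 ≤ X i) :
    (∀ i, 0 ≤ scaleMarginals r X i) ∧ (∀ i, scaleMarginals r X i ≤ X i) ∧
      (∀ k j, marg (scaleMarginals r X) k j ≤ r k j) ∧
      ∑ i, X i - ∑ i, scaleMarginals r X i ≤
        ∑ k, ∑ j, Max.max (marg X k j - r k j) 0 := by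
  obtain ⟨h1, h2, h3⟩ := foldl_scaleMarginal hr (List.finRange m) X hX
  refine ⟨fun i => (h1 i).1, fun i => (h1 i).2, fun k j => h2 k (List.mem_finRange k) j, ?_⟩
  rwa [← Fin.sum_univ_def] at h3

theorem cost_nonneg {C X : Tensor m n ℝ} (hC : ∀ i, 0 ≤ C i) (hX : ∀ i, 0 ≤ X i) :
    0 ≤ cost C X := Finset.sum_nonneg fun i _ => mul_nonneg (hC i) (hX i)

theorem cost_le_norm_mul (C : Tensor m n ℝ) {X : Tensor m n ℝ} (hX : ∀ i, 0 ≤ X i) :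
    cost C X ≤ ‖C‖ * ∑ i, X i := by
  rw [cost, Finset.mul_sum]
  exact Finset.sum_le_sum fun i _ =>
    mul_le_mul_of_nonneg_right ((le_abs_self _).trans (norm_le_pi_norm C i)) (hX i)

/-- The rounded tensor has the prescribed marginals, and rounding increases the cost by at most
`‖C‖` times the mass that has to be added. -/
theorem roundTensor_spec {C : Tensor m n ℝ} (hC : ∀ i, 0 ≤ C i) {r : Vecs m n ℝ}
    (hr : ∀ k j, 0 ≤ r k j) {s : ℝ} (hs : ∀ k, ∑ j, r k j = s) {X : Tensor m n ℝ}
    (hX : ∀ i, 0 ≤ X i) (k₀ : Fin m) :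
    IsPlan r (roundTensor r k₀ X) ∧
      cost C (roundTensor r k₀ X) ≤ cost C X +
        ‖C‖ * (s - ∑ i, X i + (margError r X + m * (∑ i, X i - s)) / 2) := by
  obtain ⟨h0, hle, hmarg, hloss⟩ := scaleMarginals_spec hr hX
  have hround : roundTensor r k₀ X = fun i => scaleMarginals r X i +
    (∏ k, (r k (i k) - marg (scaleMarginals r X) k (i k))) /
      (∑ j, |r k₀ j - marg (scaleMarginals r X) k₀ j|) ^ (m - 1) := rfl
  generalize scaleMarginals r X = Y at h0 hle hmarg hloss hround
  set e := s - ∑ i, Y i with he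
  have herr : ∀ k, ∑ j, (r k j - marg Y k j) = e := by
    intro k
    rw [Finset.sum_sub_distrib, hs, sum_marg]
  have hden : ∑ j, |r k₀ j - marg Y k₀ j| = e := by
    rw [← herr k₀]
    exact Finset.sum_congr rfl fun j _ => abs_of_nonneg (sub_nonneg.2 (hmarg k₀ j))
  rw [hden] at hround
  have he0 : 0 ≤ e := hden ▸ Finset.sum_nonneg fun j _ => _root_.abs_nonneg _
  set P : Tensor m n ℝ := fun i => (∏ k, (r k (i k) - marg Y k (i k))) / e ^ (m - 1) with hP
  have hP0 : ∀ i, 0 ≤ P i := fun i =>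
    div_nonneg (Finset.prod_nonneg fun k _ => sub_nonneg.2 (hmarg k (i k))) (pow_nonneg he0 _)
  have hPm : ∀ k j, marg P k j = r k j - marg Y k j := by
    intro k j
    have h1 : marg P k j = marg (fun i => ∏ k, (r k (i k) - marg Y k (i k))) k j / e ^ (m - 1) := by
      simp only [marg, hP, Finset.sum_div]
    rw [h1, marg_prod fun k j => r k j - marg Y k j]
    simp_rw [herr]
    rw [Finset.prod_const, Finset.card_erase_of_mem (Finset.mem_univ k), Finset.card_univ,
      Fintype.card_fin]
    -- If no mass is missing, the nonnegative defects all vanish, so the numerator is 0 whatever the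
    -- denominator. Otherwise the m - 1 other factors each sum to e and cancel the denominator.
    rcases he0.eq_or_lt with h | h
    · have hz := (Finset.sum_eq_zero_iff_of_nonneg
        fun j _ => sub_nonneg.2 (hmarg k j)).1 ((herr k).trans h.symm) j (Finset.mem_univ j)
      rw [hz, zero_mul, zero_div]
    · exact mul_div_cancel_right₀ _ (pow_pos h _).ne'
  have hcost : cost C (roundTensor r k₀ X) = cost C Y + cost C P := by
    rw [hround]
    simp only [cost, mul_add, Finset.sum_add_distrib, hP]
  refine ⟨⟨fun i => ?_, fun k j => ?_⟩, ?_⟩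
  · rw [hround]
    exact add_nonneg (h0 i) (hP0 i)
  · change marg (roundTensor r k₀ X) k j = r k j
    rw [hround]
    refine (marg_add Y P k j).trans ?_
    rw [hPm]
    ring
  · have h1 : cost C Y ≤ cost C X :=
      Finset.sum_le_sum fun i _ => mul_le_mul_of_nonneg_left (hle i) (hC i)
    have h2 := cost_le_norm_mul C hP0
    have h3 : ∑ i, P i = e := by
      rw [← sum_marg P k₀, ← herr k₀]
      exact Finset.sum_congr rfl fun j _ => hPm k₀ j
    have h4 : ∑ k, ∑ j, Max.max (marg X k j - r k j) 0 =
        (margError r X + m * (∑ i, X i - s)) / 2 := by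
      have hmax : ∀ x : ℝ, Max.max x 0 = (|x| + x) / 2 := by
        intro x
        rcases le_total x 0 with h | h
        · rw [max_eq_right h, abs_of_nonpos h]
          ring
        · rw [max_eq_left h, abs_of_nonneg h]
          ring
      simp_rw [hmax, ← Finset.sum_div, Finset.sum_add_distrib, Finset.sum_sub_distrib, sum_marg,
        hs]
      simp [margError, mul_sub]
    rw [hcost]
    rw [h3] at h2
    have h5 : e ≤ s - ∑ i, X i + (margError r X + m * (∑ i, X i - s)) / 2 := by linarith
    have h6 := mul_le_mul_of_nonneg_left h5 (norm_nonneg C)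
    linarith

/-! ### Quality of the rounded Gibbs tensor -/

/-- Among the tensors with the same marginals, `B(β)` is optimal up to an entropy term. -/
theorem cost_gibbsTensor_le (C : Tensor m n ℝ) {η : ℝ} (hη : 0 < η) (hn : 0 < n)
    (β : Vecs m n ℝ) {X : Tensor m n ℝ} (hX : ∀ i, 0 ≤ X i) (k₀ : Fin m)
    (hmarg : ∀ k j, marg X k j = marg (gibbsTensor C η β) k j) :
    cost C (gibbsTensor C η β) ≤ cost C X + gibbsMass C η β * (η * m * Real.log n) := by
  have hB := gibbsTensor_pos C η β
  have hs := gibbsMass_pos C η hn β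
  have hlog : ∀ i, Real.log (gibbsTensor C η β i) = ∑ k, β k (i k) - C i / η := fun i =>
    Real.log_exp _
  have hsumX : ∑ i, X i = gibbsMass C η β := by
    rw [← sum_marg X k₀, gibbsMass, ← sum_marg _ k₀]
    exact Finset.sum_congr rfl fun j _ => hmarg k₀ j
  -- Apart from -C/η, log B(β) is a sum of functions of single indices. For fixed marginals, ⟨Z, log
  -- B(β)⟩ therefore depends on Z only through its cost.
  have hlin : ∀ Z : Tensor m n ℝ, (∀ k j, marg Z k j = marg (gibbsTensor C η β) k j) →
      ∑ i, Z i * Real.log (gibbsTensor C η β i) =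
        ∑ k, ∑ j, marg (gibbsTensor C η β) k j * β k j - cost C Z / η := by
    intro Z hZ
    simp_rw [hlog, mul_sub, Finset.sum_sub_distrib, ← hZ, sum_marg_mul, Finset.mul_sum, cost,
      Finset.sum_div]
    rw [Finset.sum_comm]
    congr 1
    exact Finset.sum_congr rfl fun i _ => by ring
  -- Gibbs' inequality for X against B(β), which have equal mass, combined with X ≤ mass entrywise.
  have h1 : ∑ i, X i * Real.log (gibbsTensor C η β i) ≤
      gibbsMass C η β * Real.log (gibbsMass C η β) := by
    have hi : ∀ i, X i - gibbsTensor C η β i ≤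
        X i * Real.log (gibbsMass C η β) - X i * Real.log (gibbsTensor C η β i) := by
      intro i
      rcases (hX i).eq_or_lt with h | h
      · rw [← h]
        simpa using (hB i).le
      · have h2 := mul_log_div_ge (hX i) (hB i)
        have h3 : X i ≤ gibbsMass C η β :=
          hsumX ▸ Finset.single_le_sum (fun i _ => hX i) (Finset.mem_univ i)
        have h4 := mul_le_mul_of_nonneg_left (Real.log_le_log h h3) (hX i)
        rw [Real.log_div h.ne' (hB i).ne'] at h2
        nlinarith [sq_nonneg (Real.sqrt (X i) - Real.sqrt (gibbsTensor C η β i))]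
    have := Finset.sum_le_sum fun i (_ : i ∈ Finset.univ) => hi i
    rw [Finset.sum_sub_distrib, Finset.sum_sub_distrib, ← Finset.sum_mul, hsumX] at this
    have h0 : ∑ i, gibbsTensor C η β i = gibbsMass C η β := rfl
    linarith
  -- Gibbs' inequality for B(β) against the uniform tensor of the same mass; log(n^m) is the source
  -- of m log n.
  have h2 : gibbsMass C η β * Real.log (gibbsMass C η β) - gibbsMass C η β * (m * Real.log n) ≤
      ∑ i, gibbsTensor C η β i * Real.log (gibbsTensor C η β i) := by
    have hN : (0 : ℝ) < (n : ℝ) ^ m := by positivity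
    have hi : ∀ i, gibbsTensor C η β i - gibbsMass C η β / (n : ℝ) ^ m ≤
        gibbsTensor C η β i * Real.log (gibbsTensor C η β i) - gibbsTensor C η β i *
          (Real.log (gibbsMass C η β) - m * Real.log n) := by
      intro i
      have h3 := mul_log_div_ge (hB i).le (div_pos hs hN)
      rw [Real.log_div (hB i).ne' (div_pos hs hN).ne', Real.log_div hs.ne' hN.ne',
        Real.log_pow] at h3
      nlinarith [sq_nonneg (Real.sqrt (gibbsTensor C η β i) -
        Real.sqrt (gibbsMass C η β / (n : ℝ) ^ m))]
    have := Finset.sum_le_sum fun i (_ : i ∈ Finset.univ) => hi i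
    rw [Finset.sum_sub_distrib, Finset.sum_sub_distrib, ← Finset.sum_mul] at this
    have h0 : ∑ i, gibbsTensor C η β i = gibbsMass C η β := rfl
    have h4 : ∑ _i : Fin m → Fin n, gibbsMass C η β / (n : ℝ) ^ m = gibbsMass C η β := by
      rw [Finset.sum_const, Finset.card_univ, Fintype.card_pi_const, Fintype.card_fin, nsmul_eq_mul]
      push_cast
      field_simp
    rw [h0, h4] at this
    linarith
  rw [hlin _ fun _ _ => rfl] at h2
  rw [hlin X hmarg] at h1
  have h3 : cost C (gibbsTensor C η β) / η ≤
      cost C X / η + gibbsMass C η β * (m * Real.log n) := by linarith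
  have h4 := mul_le_mul_of_nonneg_right h3 hη.le
  rw [add_mul, div_mul_cancel₀ _ hη.ne', div_mul_cancel₀ _ hη.ne'] at h4
  linarith

/-- Rounding is used twice: B(β) to the marginals r, and Y to the marginals of B(β), which gives a
competitor there. The two mass corrections are opposite and cancel, leaving ‖C‖ times the residue.
-/
theorem cost_roundTensor_gibbsTensor_le {C : Tensor m n ℝ} (hC : ∀ i, 0 ≤ C i) {η : ℝ}
    (hη : 0 < η) (hn : 0 < n) {r : Vecs m n ℝ} (hr : ∀ k j, 0 ≤ r k j)
    (hsum : ∀ k, ∑ j, r k j = 1) (β : Vecs m n ℝ) (k₀ : Fin m) {Y : Tensor m n ℝ}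
    (hY : IsPlan r Y) :
    cost C (roundTensor r k₀ (gibbsTensor C η β)) ≤ cost C Y +
      ‖C‖ * margError r (gibbsTensor C η β) + gibbsMass C η β * (η * m * Real.log n) := by
  have hB : ∀ i, 0 ≤ gibbsTensor C η β i := fun i => (gibbsTensor_pos C η β i).le
  have hYm : ∀ k j, marg Y k j = r k j := hY.2
  have hYsum : ∑ i, Y i = 1 := by
    rw [← sum_marg Y k₀, ← hsum k₀]
    exact Finset.sum_congr rfl fun j _ => hYm k₀ j
  have h1 := (roundTensor_spec hC hr hsum hB k₀).2
  obtain ⟨h2, h3⟩ := roundTensor_spec hC (fun k j => marg_nonneg hB k j)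
    (fun k => sum_marg (gibbsTensor C η β) k) hY.1 k₀
  have h4 := cost_gibbsTensor_le C hη hn β h2.1 k₀ h2.2
  have h5 : margError (marg (gibbsTensor C η β)) Y = margError r (gibbsTensor C η β) := by
    simp only [margError, hYm]
    exact Finset.sum_congr rfl fun k _ => Finset.sum_congr rfl fun j _ => abs_sub_comm _ _
  rw [h5, hYsum] at h3
  linarith

theorem exists_isOptimalPlan {C : Tensor m n ℝ} (hC : ∀ i, 0 ≤ C i) {r : Vecs m n ℝ}
    (hr : ∀ k j, 0 ≤ r k j) (hsum : ∀ k, ∑ j, r k j = 1) (k₀ : Fin m) :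
    ∃ X, IsOptimalPlan C r X := by
  have hne : {X | IsPlan r X}.Nonempty :=
    -- Rounding the zero tensor yields the product plan.
    ⟨_, (roundTensor_spec hC hr hsum (X := fun _ => 0) (fun _ => le_rfl) k₀).1⟩
  have hclosed : IsClosed {X : Tensor m n ℝ | IsPlan r X} := by
    simp only [IsPlan, Set.ofPred_and, Set.ofPred_forall]
    refine (isClosed_iInter fun i => isClosed_le continuous_const (by fun_prop)).inter
      (isClosed_iInter fun k => isClosed_iInter fun j => isClosed_eq (by fun_prop)
        continuous_const)
  have hsub : {X : Tensor m n ℝ | IsPlan r X} ⊆ Set.Icc 0 1 := by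
    intro X hX
    refine ⟨hX.1, fun i => ?_⟩
    refine (le_marg hX.1 k₀ i).trans ((hX.2 k₀ (i k₀)).trans_le ?_)
    rw [Pi.one_apply, ← hsum k₀]
    exact Finset.single_le_sum (fun j _ => hr k₀ j) (Finset.mem_univ _)
  obtain ⟨X, hX, hmin⟩ := (isCompact_Icc.of_isClosed_subset hclosed hsub).exists_isMinOn hne
    (f := cost C) (by unfold cost; fun_prop)
  exact ⟨X, hX, fun Y hY => hmin hY⟩

end Rounding

/-! ### Approximate optimality and complexity -/

section Main

variable {m n : ℕ}

theorem sum_smoothMarginals (hn : 0 < n) (δ : ℝ) {r : Vecs m n ℝ} (hsum : ∀ k, ∑ j, r k j = 1)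
    (k : Fin m) : ∑ j, smoothMarginals δ r k j = 1 := by
  have hm : 0 < m := k.pos
  simp only [smoothMarginals, Finset.sum_add_distrib, ← Finset.mul_sum, hsum, Finset.sum_const,
    Finset.card_univ, Fintype.card_fin, nsmul_eq_mul]
  field_simp
  ring

theorem le_smoothMarginals {δ : ℝ} (hm : 0 < m) (hδ : δ ≤ 4 * m) {r : Vecs m n ℝ}
    (hr : ∀ k j, 0 ≤ r k j) (k : Fin m) (j : Fin n) :
    δ / (4 * m * n) ≤ smoothMarginals δ r k j := by
  have : δ / (4 * m) ≤ 1 := (div_le_one (by positivity)).2 hδ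
  exact le_add_of_nonneg_left (mul_nonneg (sub_nonneg.2 this) (hr k j))

theorem margError_le_smooth (hm : 0 < m) (hn : 0 < n) {δ : ℝ} (hδ : 0 ≤ δ) {r : Vecs m n ℝ}
    (hr : ∀ k j, 0 ≤ r k j) (hsum : ∀ k, ∑ j, r k j = 1) (X : Tensor m n ℝ) :
    margError r X ≤ margError (smoothMarginals δ r) X + δ / 2 := by
  have hj : ∀ k j, |marg X k j - r k j| ≤ |marg X k j - smoothMarginals δ r k j| +
      (δ / (4 * m) * r k j + δ / (4 * m) * (1 / n)) := by
    intro k j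
    have h1 : |smoothMarginals δ r k j - r k j| ≤
        δ / (4 * m) * r k j + δ / (4 * m) * (1 / n) := by
      have h2 : smoothMarginals δ r k j - r k j =
          δ / (4 * m) * (1 / n) - δ / (4 * m) * r k j := by
        rw [smoothMarginals]
        field_simp
        ring
      have h3 : 0 ≤ δ / (4 * m) * r k j := mul_nonneg (by positivity) (hr k j)
      have h4 : 0 ≤ δ / (4 * m) * (1 / n) := by positivity
      rw [h2, abs_le]
      constructor <;> linarith
    exact (abs_sub_le _ (smoothMarginals δ r k j) _).trans (add_le_add_right h1 _)
  have h := Finset.sum_le_sum fun k (_ : k ∈ Finset.univ) =>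
    Finset.sum_le_sum fun j (_ : j ∈ Finset.univ) => hj k j
  simp only [Finset.sum_add_distrib, ← Finset.mul_sum, hsum, Finset.sum_const, Finset.card_univ,
    Fintype.card_fin, nsmul_eq_mul] at h
  -- Each of the m blocks moves by at most 2 · δ/(4m).
  refine h.trans (add_le_add_right (le_of_eq ?_) _)
  field_simp
  ring

theorem isApproxPlan_of_residue_le (hm : 0 < m) (hn : 2 ≤ n) {C : Tensor m n ℝ}
    (hC : ∀ i, 0 ≤ C i) (hC0 : 0 < ‖C‖) {r : Vecs m n ℝ} (hr : ∀ k j, 0 ≤ r k j)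
    (hsum : ∀ k, ∑ j, r k j = 1) {ε η δ : ℝ} (hε : 0 < ε) (hη : η = ε / (2 * m * Real.log n))
    (hδ : δ = ε / (8 * ‖C‖)) (k₀ : Fin m) (β : Vecs m n ℝ)
    (hres : margError (smoothMarginals δ r) (gibbsTensor C η β) ≤ δ / 2) :
    IsApproxPlan C r ε (roundTensor r k₀ (gibbsTensor C η β)) := by
  have hlog : 0 < Real.log n := Real.log_pos (by exact_mod_cast hn)
  have hm' : (1 : ℝ) ≤ m := by exact_mod_cast hm
  have hn0 : 0 < n := by omega
  have hη0 : 0 < η := by rw [hη]; positivity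
  have hδ0 : 0 < δ := by rw [hδ]; positivity
  have hB : ∀ i, 0 ≤ gibbsTensor C η β i := fun i => (gibbsTensor_pos C η β i).le
  have hplan := (roundTensor_spec hC hr hsum hB k₀).1
  obtain ⟨Y, hY⟩ := exists_isOptimalPlan hC hr hsum k₀
  refine ⟨hplan, Y, hY, ?_⟩
  have hεC : ‖C‖ * δ = ε / 8 := by
    rw [hδ]
    field_simp
  -- If ‖C‖ ≤ ε every plan is good enough. Otherwise δ ≤ 1/8, the mass is at most 1 + δ, and the
  -- error is at most ε/8 + (9/8)(ε/2) < ε.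
  by_cases hbig : ‖C‖ ≤ ε
  · have h1 := cost_le_norm_mul C hplan.1
    have h2 : ∑ i, roundTensor r k₀ (gibbsTensor C η β) i = 1 := by
      rw [← sum_marg _ k₀, ← hsum k₀]
      exact Finset.sum_congr rfl fun j _ => hplan.2 k₀ j
    rw [h2, mul_one] at h1
    linarith [cost_nonneg hC hY.1.1]
  · push Not at hbig
    have hδ8 : δ ≤ 1 / 8 := by
      rw [hδ, div_le_div_iff₀ (by positivity) (by norm_num)]
      linarith
    have herr := (margError_le_smooth hm hn0 hδ0.le hr hsum (gibbsTensor C η β)).trans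
      (add_le_add_left hres _)
    rw [add_halves] at herr
    have h1 := cost_roundTensor_gibbsTensor_le hC hη0 hn0 hr hsum β k₀ hY.1
    have h2 : η * m * Real.log n = ε / 2 := by
      rw [hη]
      field_simp
    have h3 : gibbsMass C η β ≤ 1 + δ := by
      have h4 : gibbsMass C η β - 1 ≤ margError r (gibbsTensor C η β) := by
        calc gibbsMass C η β - 1 = ∑ j, (marg (gibbsTensor C η β) k₀ j - r k₀ j) := by
              rw [Finset.sum_sub_distrib, sum_marg, hsum]
              rfl
          _ ≤ ∑ j, |marg (gibbsTensor C η β) k₀ j - r k₀ j| :=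
              Finset.sum_le_sum fun j _ => le_abs_self _
          _ ≤ _ := Finset.single_le_sum
              (f := fun k => ∑ j, |marg (gibbsTensor C η β) k j - r k j|)
              (fun k _ => Finset.sum_nonneg fun j _ => _root_.abs_nonneg _) (Finset.mem_univ k₀)
      linarith
    rw [h2] at h1
    have h5 := mul_le_mul_of_nonneg_left herr hC0.le
    nlinarith

/-- The stopping criterion is met after few iterations. -/
theorem exists_accResidue_le (hm : 2 ≤ m) (hn : 2 ≤ n) {C : Tensor m n ℝ}
    (hC : ∀ i, 0 ≤ C i) (hC0 : 0 < ‖C‖) {r : Vecs m n ℝ} (hr : ∀ k j, 0 ≤ r k j)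
    (hsum : ∀ k, ∑ j, r k j = 1) {ε η δ : ℝ} (hε : 0 < ε) (hεC : ε ≤ 32 * m * ‖C‖)
    (hη : η = ε / (2 * m * Real.log n)) (hδ : δ = ε / (8 * ‖C‖)) (tie : TieRule m) (k₀ : Fin m)
    (q : ℕ) (hq : 0 < q)
    (hqQ : 2 ^ 25 * ((m : ℝ) ^ 2 * n * (m * ‖C‖ / ε) ^ 4 * Real.log n ^ 2) ≤ (q : ℝ) ^ 3) :
    ∃ T ≤ 2 * q, accResidue tie C η (smoothMarginals δ r) k₀ T ≤ δ / 2 := by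
  by_contra! hcon
  have hlog : 0 < Real.log n := Real.log_pos (by exact_mod_cast hn)
  have hm0 : (0 : ℝ) < m := by exact_mod_cast (show 0 < m by omega)
  have hn0 : (0 : ℝ) < n := by exact_mod_cast (show 0 < n by omega)
  have hη0 : 0 < η := by rw [hη]; positivity
  have hδ0 : 0 < δ := by rw [hδ]; positivity
  have hδm : δ ≤ 4 * m := by
    rw [hδ, div_le_iff₀ (by positivity)]
    linarith
  -- The scale x makes all parameters simple: ‖C‖/η = x log n/16, the lower bound on the marginals
  -- is 1/(xn), and δ/2 = 2m/x. The upper bound on ε says exactly x ≥ 1.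
  obtain ⟨x, hx⟩ : ∃ x, x = 32 * m * ‖C‖ / ε := ⟨_, rfl⟩
  have hx1 : 1 ≤ x := by rwa [hx, one_le_div hε]
  have hρ : 0 < δ / (4 * m * n) := by positivity
  have hlow := le_smoothMarginals (show 0 < m by omega) hδm hr
  have hsum' := sum_smoothMarginals (show 0 < n by omega) δ hsum
  obtain ⟨γ, hγ, hbound⟩ := exists_minimiser C (show 0 < n by omega) hC hη0 hρ hlow hsum'
  have hlogn : 1 / 2 ≤ Real.log n := by
    have h1 : Real.log 2 ≤ Real.log n :=
      Real.log_le_log (by norm_num) (by exact_mod_cast hn)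
    linarith [Real.log_two_gt_d9]
  have hR : ‖C‖ / η - Real.log (δ / (4 * m * n)) ≤ 4 * (x * Real.log n) := by
    have h1 : ‖C‖ / η = x * Real.log n / 16 := by
      rw [hη, hx]
      field_simp
      norm_num
    have h2 : δ / (4 * m * n) = (x * n)⁻¹ := by
      rw [hδ, hx]
      field_simp
      norm_num
    have hx0 : 0 < x := by linarith
    rw [h1, h2, Real.log_inv, Real.log_mul hx0.ne' hn0.ne']
    nlinarith [Real.log_le_sub_one_of_pos hx0, mul_le_mul_of_nonneg_left hlogn hx0.le,
      mul_le_mul_of_nonneg_right hx1 hlog.le]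
  have hnorm : ∑ k, ∑ j, γ k j ^ 2 ≤ m * (n * (4 * (x * Real.log n)) ^ 2) := by
    have : ∀ k j, γ k j ^ 2 ≤ (4 * (x * Real.log n)) ^ 2 := by
      intro k j
      rw [← sq_abs]
      exact pow_le_pow_left₀ (_root_.abs_nonneg _) ((hbound k j).trans hR) 2
    have h := Finset.sum_le_sum fun k (_ : k ∈ Finset.univ) =>
      Finset.sum_le_sum fun j (_ : j ∈ Finset.univ) => this k j
    simpa using h
  -- Equal halves s = d = q. The contradiction will be q(q+2)² ≤ q³ with q > 0.
  have h1 := accResidue_large_bound tie C η k₀ (fun k j => hρ.trans_le (hlow k j)) hsum'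
    (by omega) (by omega) γ hγ (tol := δ / 2) (by positivity) q q
    (fun i hi => hcon i (by omega))
  have h2 : (q : ℝ) * (δ / 2) ^ 2 * (q + 2) ^ 2 ≤
      8 * m ^ 3 * (m * (n * (4 * (x * Real.log n)) ^ 2)) :=
    h1.trans (mul_le_mul_of_nonneg_left hnorm (by positivity))
  have hδx : δ / 2 = 2 * m / x := by
    rw [hδ, hx]
    field_simp
    norm_num
  have hx0 : 0 < x := by linarith
  have h3 : (q : ℝ) * (q + 2) ^ 2 ≤ 32 * (m ^ 2 * n * x ^ 4 * Real.log n ^ 2) := by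
    rw [hδx, div_pow, mul_div_assoc', div_mul_eq_mul_div, div_le_iff₀ (by positivity)] at h2
    have h4 : (4 * (m : ℝ) ^ 2) * (q * (q + 2) ^ 2) ≤
        (4 * m ^ 2) * (32 * (m ^ 2 * n * x ^ 4 * Real.log n ^ 2)) := by linarith
    exact le_of_mul_le_mul_left h4 (by positivity)
  have h5 : 32 * (m ^ 2 * n * x ^ 4 * Real.log n ^ 2) =
      2 ^ 25 * ((m : ℝ) ^ 2 * n * (m * ‖C‖ / ε) ^ 4 * Real.log n ^ 2) := by
    rw [hx]
    ring
  have hq0 : (0 : ℝ) < q := by exact_mod_cast hq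
  rw [h5] at h3
  nlinarith [h3.trans hqQ]

end Main

end MOT

/-! ### The main theorem: first stopping time and total count -/

theorem theorem5p3 :
    ∃ K : ℝ, 0 < K ∧
      ∀ (m n : ℕ) (hm : 2 ≤ m) (_hn : 2 ≤ n) (C : MOT.Tensor m n ℝ) (r : MOT.Vecs m n ℝ) (ε : ℝ),
        (∀ i, 0 ≤ C i) → (∀ k, r k ∈ stdSimplex ℝ (Fin n)) →
        0 < ε → ε ≤ 32 * (m : ℝ) * ‖C‖ →
        ∀ tie : MOT.TieRule m, ∃ (Xhat : MOT.Tensor m n ℝ) (N : ℕ),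
          MOT.Returns (MOT.approxMOT tie C r ε ⟨0, by omega⟩) Xhat N ∧
          MOT.IsApproxPlan C r ε Xhat ∧
          (N : ℝ) ≤ K * ((m : ℝ) ^ 3 * (n : ℝ) ^ ((m : ℝ) + 1 / 3) * ‖C‖ ^ (4 / 3 : ℝ) *
            Real.log n ^ (2 / 3 : ℝ) / ε ^ (4 / 3 : ℝ)) := by
  -- 422400 = 1408 · 300: at most 1408 Q iterations of 300 m n^m instructions each.
  refine ⟨422400, by norm_num, ?_⟩
  intro m n hm hn C r ε hC hr hε hεC tie
  have hr0 : ∀ k j, 0 ≤ r k j := fun k j => (hr k).1 j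
  have hsum : ∀ k, ∑ j, r k j = 1 := fun k => (hr k).2
  have hm0 : (0 : ℝ) < m := by exact_mod_cast (show 0 < m by omega)
  have hn0 : (0 : ℝ) < n := by exact_mod_cast (show 0 < n by omega)
  have hC0 : 0 < ‖C‖ := by
    by_contra h
    have : ‖C‖ = 0 := le_antisymm (not_lt.1 h) (norm_nonneg C)
    rw [this, mul_zero] at hεC
    linarith
  have hlog : 0 < Real.log n := Real.log_pos (by exact_mod_cast hn)
  have hlogn : 1 / 2 ≤ Real.log n := by
    have h1 : Real.log 2 ≤ Real.log n :=
      Real.log_le_log (by norm_num) (by exact_mod_cast hn)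
    linarith [Real.log_two_gt_d9]
  obtain ⟨Q, hQ⟩ : ∃ Q : ℝ, Q = (m : ℝ) ^ 2 * (n : ℝ) ^ (1 / 3 : ℝ) * ‖C‖ ^ (4 / 3 : ℝ) *
    Real.log n ^ (2 / 3 : ℝ) / ε ^ (4 / 3 : ℝ) := ⟨_, rfl⟩
  have hQ0 : 0 < Q := by rw [hQ]; positivity
  have hcube : Q ^ 3 = (m : ℝ) ^ 2 * n * (m * ‖C‖ / ε) ^ 4 * Real.log n ^ 2 := by
    have e1 : ((n : ℝ) ^ (1 / 3 : ℝ)) ^ 3 = n := by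
      rw [← Real.rpow_natCast, ← Real.rpow_mul hn0.le]
      norm_num
    have e2 : ∀ y : ℝ, 0 < y → (y ^ (4 / 3 : ℝ)) ^ 3 = y ^ 4 := by
      intro y hy
      rw [← Real.rpow_natCast, ← Real.rpow_mul hy.le, ← Real.rpow_natCast]
      norm_num
    have e3 : (Real.log n ^ (2 / 3 : ℝ)) ^ 3 = Real.log n ^ 2 := by
      rw [← Real.rpow_natCast, ← Real.rpow_mul hlog.le, ← Real.rpow_natCast]
      norm_num
    rw [hQ, div_pow, mul_pow, mul_pow, mul_pow, e1, e2 _ hC0, e2 _ hε, e3]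
    field_simp
  -- This lower bound lets the additive constants from rounding up be absorbed: 2⌈512 Q⌉ + 1 ≤ 1024
  -- Q + 3 ≤ 1408 Q.
  have hQlow : 1 / 128 ≤ Q := by
    have h1 : 1 / 32 ≤ m * ‖C‖ / ε := by
      rw [le_div_iff₀ hε]
      linarith
    have hm2 : (2 : ℝ) ≤ m := by exact_mod_cast hm
    have hn2 : (2 : ℝ) ≤ n := by exact_mod_cast hn
    have h2 : (2 : ℝ) ^ 2 * 2 * (1 / 32) ^ 4 * (1 / 2) ^ 2 ≤ Q ^ 3 := by
      rw [hcube]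
      gcongr
    refine le_of_pow_le_pow_left₀ three_ne_zero hQ0.le (le_trans ?_ h2)
    norm_num
  -- 512³ = 2^27 exceeds the required 2^25.
  have hceil := Nat.le_ceil (512 * Q)
  have hq : 0 < ⌈512 * Q⌉₊ := Nat.ceil_pos.2 (by positivity)
  have hqQ : 2 ^ 25 * ((m : ℝ) ^ 2 * n * (m * ‖C‖ / ε) ^ 4 * Real.log n ^ 2) ≤
      (⌈512 * Q⌉₊ : ℝ) ^ 3 := by
    rw [← hcube]
    refine le_trans ?_ (pow_le_pow_left₀ (by positivity) hceil 3)
    have := pow_pos hQ0 3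
    rw [mul_pow]
    nlinarith
  have hex := MOT.exists_accResidue_le hm hn hC hC0 hr0 hsum hε hεC rfl rfl tie
    ⟨0, by omega⟩ _ hq hqQ
  classical
  have hex' : ∃ T, MOT.accResidue tie C (ε / (2 * m * Real.log n))
      (MOT.smoothMarginals (ε / (8 * ‖C‖)) r) ⟨0, by omega⟩ T ≤ ε / (8 * ‖C‖) / 2 :=
    hex.imp fun _ h => h.2
  obtain ⟨T₁, hT₁, hdone₁⟩ := hex
  have hT : Nat.find hex' ≤ 2 * ⌈512 * Q⌉₊ := (Nat.find_min' hex' hdone₁).trans hT₁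
  obtain ⟨N, hret, hN⟩ := MOT.returns_approxMOT tie C r ε ⟨0, by omega⟩ hm hn _ _ rfl rfl
    (Nat.find hex') (fun i hi => not_le.1 (Nat.find_min hex' hi)) (Nat.find_spec hex')
  refine ⟨_, N, hret, MOT.isApproxPlan_of_residue_le (by omega) hn hC hC0 hr0 hsum hε rfl rfl
    _ _ (Nat.find_spec hex'), ?_⟩
  have hT' : (Nat.find hex' : ℝ) ≤ 2 * ⌈512 * Q⌉₊ := by exact_mod_cast hT
  have hceil' := Nat.ceil_lt_add_one (show 0 ≤ 512 * Q by positivity)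
  have hT1 : (Nat.find hex' : ℝ) + 1 ≤ 1408 * Q := by linarith
  have hN' : (N : ℝ) ≤ ((Nat.find hex' : ℝ) + 1) * (300 * (m * (n : ℝ) ^ m)) := by
    exact_mod_cast hN
  have hfin : 422400 * ((m : ℝ) ^ 3 * (n : ℝ) ^ ((m : ℝ) + 1 / 3) * ‖C‖ ^ (4 / 3 : ℝ) *
      Real.log n ^ (2 / 3 : ℝ) / ε ^ (4 / 3 : ℝ)) = 1408 * Q * (300 * (m * (n : ℝ) ^ m)) := by
    rw [hQ, Real.rpow_add hn0, Real.rpow_natCast]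
    ring
  rw [hfin]
  exact hN'.trans (mul_le_mul_of_nonneg_right hT1 (by positivity))
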